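/- **Conventions.** A *semigroup variety* is the class of all semigroups satisfying some set of identities between semigroup words, i.e. elements of the free semigroup $F$ over a countably infinite alphabet. An *epigroup* is a semigroup $S$ in which every $x$ has some power $x^n$ ($n\ge 1$) lying in a subgroup of $S$; if $e_x$ is the identity element of the maximal subgroup $G$ containing some power of $x$, then the *pseudoinverse* $\overline{x}$ is the inverse of $xe_x$ in $G$. An *epigroup variety* is a class of epigroups, considered as algebras with multiplication and pseudoinversion, that consists of all unary semigroups (semigroups with an additional unary operation) satisfying some set of identities between unary words, i.e. elements of the free unary semigroup over the same alphabet. $\mathbb{SEM}$ and $\mathbb{EPI}$ are the lattices of all semigroup varieties and of all epigroup varieties, ordered by inclusion. $\mathbf{T}$ is the variety of trivial (one-element) algebras and $\mathbf{SL}$ is the variety of semilattices (given by $x^2\approx x$, $xy\approx yx$). A *nil-variety* is a variety consisting of nilsemigroups, i.e. semigroups with a zero in which every element has a power equal to $0$. An element $x$ of a lattice $L$ is *modular* if $(x\vee y)\wedge z=(x\wedge z)\vee y$ for all $y\le z$ in $L$. "Words" are semigroup words in the semigroup case and unary words in the epigroup case. For a word $\mathbf u$, $\mathrm{alph}(\mathbf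 u)$ is the set of letters occurring in it. An identity $\mathbf u\approx\mathbf v$ is *substitutive* if $\mathrm{alph}(\mathbf u)=\mathrm{alph}(\mathbf v)$ and $\mathbf v$ is obtained from $\mathbf u$ by renaming letters. $\mathbf w\approx 0$ abbreviates $\mathbf wx\approx x\mathbf w\approx\mathbf w$, where $x$ is a letter not in $\mathrm{alph}(\mathbf w)$. For a variety $\mathbf V$ let $\mathrm{Stab}_{\mathbf V}(\mathbf u)$ be the group of all permutations $\sigma$ of $\mathrm{alph}(\mathbf u)$ such that $\mathbf u\approx\sigma(\mathbf u)$ holds in $\mathbf V$, where $\sigma$ acts on words by renaming letters. For $\mathbf u,\mathbf v\in F$ write $\mathbf u\le\mathbf v$ if $\mathbf v=\mathbf a\,\xi(\mathbf u)\,\mathbf b$ for some endomorphism $\xi$ of $F$ and some possibly empty words $\mathbf a,\mathbf b$; $\mathbf u$ and $\mathbf v$ are *equivalent* if $\mathbf u\le\mathbf v$ and $\mathbf v\le\mathbf u$. When $|\mathrm{alph}(\mathbf u)|=n$, identify the permutations of $\mathrm{alph}(\mathbf u)$ with the elements of the symmetric group $S_n$ (the conditions below do not depend on the identification). Let $A_n$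 be the alternating group, $T_{ij}=\langle(ij)\rangle\le S_3$, and let $I_{ij,st}\le S_4$ be the dihedral group of order $8$ generated by $(ij)$, $(st)$ and $(is)(jt)$. **Theorem 1.2.** Let $\mathbf M\in\{\mathbf T,\mathbf{SL}\}$, and let $\mathbf N$ be a nil-variety of semigroups [respectively, epigroups] satisfying the following conditions: * (a) for each non-substitutive identity $\mathbf u\approx\mathbf v$ that holds in $\mathbf N$, the identities $\mathbf u\approx 0$ and $\mathbf v\approx 0$ also hold in $\mathbf N$; * (b) for each word $\mathbf u$, if $\mathbf N$ does not satisfy $\mathbf u\approx 0$, then $\mathrm{Stab}_{\mathbf N}(\mathbf u)$ is a modular element of the subgroup lattice of the symmetric group on $\mathrm{alph}(\mathbf u)$; * (c') there are no non-equivalent semigroup words $\mathbf u,\mathbf v$ such that $\mathrm{alph}(\mathbf u)=\mathrm{alph}(\mathbf v)$ and one of the following holds: * $\mathrm{Stab}_{\mathbf N}(\mathbf u),\mathrm{Stab}_{\mathbf N}(\mathbf v)\in\{T_{12},T_{23},T_{13}\}$; * $\mathrm{Stab}_{\mathbf N}(\mathbf u)\in\{T_{12},T_{23},T_{13}\}$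 and $\mathrm{Stab}_{\mathbf N}(\mathbf v)=A_3$; * $\mathrm{Stab}_{\mathbf N}(\mathbf u),\mathrm{Stab}_{\mathbf N}(\mathbf v)\in\{I_{12,34},I_{13,24},I_{14,23}\}$; * $\mathrm{Stab}_{\mathbf N}(\mathbf u)\in\{I_{12,34},I_{13,24},I_{14,23}\}$ and $\mathrm{Stab}_{\mathbf N}(\mathbf v)=A_4$. Then $\mathbf M\vee\mathbf N$ is a modular element of the lattice $\mathbb{SEM}$ [respectively, $\mathbb{EPI}$]. -/

import Mathlib

universe u v

/-! ### Modular elements of lattices -/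

/-- `x` is a modular element of the lattice `L`:
for all `y ≤ z` one has `(x ∨ y) ∧ z = (x ∧ z) ∨ y`. -/
def IsModularElement {L : Type v} [Lattice L] (x : L) : Prop :=
  ∀ y z : L, y ≤ z → (x ⊔ y) ⊓ z = (x ⊓ z) ⊔ y

/-! ### Some notions for semigroups -/

/-- `posPow a n` is the power `a ^ (n + 1)` in a semigroup; so `posPow a` runs through all powers
of `a` with positive exponent. -/
def posPow {S : Type v} [Mul S] (a : S) : ℕ → S
  | 0 => a
  | n + 1 => posPow a n * a

/-- A nilsemigroup: a semigroup with a zero in which some positive power of each element is the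
zero. -/
def IsNilsemigroup (S : Type v) [Semigroup S] : Prop :=
  ∃ z : S, (∀ a, z * a = z ∧ a * z = z) ∧ ∀ a, ∃ n, posPow a n = z

/-- For an idempotent `e`, the largest subgroup of the semigroup `S` with identity element `e`. -/
def maximalSubgroup {S : Type v} [Semigroup S] (e : S) : Set S :=
  {a | (e * a = a ∧ a * e = a) ∧ ∃ b, (e * b = b ∧ b * e = b) ∧ a * b = e ∧ b * a = e}

/-- `y` is the pseudoinverse of `x`: some positive power of `x` lies in the maximal subgroup with
identity element `e`, and `y` is the inverse of `x * e` in that subgroup. -/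
def IsPseudoinverse {S : Type v} [Semigroup S] (x y : S) : Prop :=
  ∃ e : S, e * e = e ∧ (∃ n, posPow x n ∈ maximalSubgroup e) ∧
    y ∈ maximalSubgroup e ∧ (x * e) * y = e ∧ y * (x * e) = e

/-- A unary semigroup: a semigroup with an additional unary operation. -/
class UnarySemigroup (S : Type v) extends Semigroup S where
  /-- the unary operation -/
  bar : S → S

/-- The unary semigroup `S` is an epigroup and its unary operation is pseudoinversion. -/
def IsEpigroup (S : Type v) [UnarySemigroup S] : Prop :=
  ∀ x : S, IsPseudoinverse x (UnarySemigroup.bar x)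

/-- A (nonempty) semigroup. -/
structure SemigroupModel : Type (u + 1) where
  carrier : Type u
  [semigroup : Semigroup carrier]
  [nonempty : Nonempty carrier]

attribute [instance] SemigroupModel.semigroup SemigroupModel.nonempty

/-- A (nonempty) unary semigroup. -/
structure UnaryModel : Type (u + 1) where
  carrier : Type u
  [unarySemigroup : UnarySemigroup carrier]
  [nonempty : Nonempty carrier]

attribute [instance] UnaryModel.unarySemigroup UnaryModel.nonempty

/-! ### Semigroup words -/

/-- The free semigroup of countably infinite rank. -/
abbrev SWord : Type := FreeSemigroup ℕ

namespace SWord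

/-- The value of a word under an assignment of the letters. -/
def eval {S : Type v} [Semigroup S] (φ : ℕ → S) (w : SWord) : S := FreeSemigroup.lift φ w

/-- The set of letters that occur in a word. -/
def content (w : SWord) : Finset ℕ := insert w.head w.tail.toFinset

/-- Renaming of the letters of a word. -/
def rename (f : ℕ → ℕ) (w : SWord) : SWord := FreeSemigroup.map f w

theorem eval_rename {S : Type v} [Semigroup S] (φ : ℕ → S) (f : ℕ → ℕ) (w : SWord) :
    eval φ (rename f w) = eval (φ ∘ f) w := by
  have h : (FreeSemigroup.lift φ).comp (FreeSemigroup.map f) = FreeSemigroup.lift (φ ∘ f) := by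
    apply FreeSemigroup.hom_ext
    funext i
    rfl
  exact DFunLike.congr_fun h w

/-- The quasi-order on words: `u ≤ v` if `v = a ξ(u) b` for some endomorphism `ξ` of the free
semigroup and some possibly empty words `a`, `b`. -/
def LE (u v : SWord) : Prop :=
  ∃ (ξ : SWord →ₙ* SWord) (a b : WithOne SWord),
    (v : WithOne SWord) = a * (ξ u : WithOne SWord) * b

/-- Equivalence of words. -/
def Equivalent (u v : SWord) : Prop := LE u v ∧ LE v u

end SWord

/-! ### Unary words -/

/-- The free unary semigroup of countably infinite rank. Each of its elements is, in a unique way,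
a nonempty product of factors each of which is either a letter or of the form `bar w`; the last two
constructors put one such factor in front of a word. -/
inductive UWord : Type
  | letter (i : ℕ) : UWord
  | bar (w : UWord) : UWord
  | letterMul (i : ℕ) (w : UWord) : UWord
  | barMul (v w : UWord) : UWord

namespace UWord

/-- Concatenation of unary words. -/
def mul : UWord → UWord → UWord
  | letter i, w => letterMul i w
  | bar v, w => barMul v w
  | letterMul i v, w => letterMul i (mul v w)
  | barMul v v', w => barMul v (mul v' w)

theorem mul_assoc' (a b c : UWord) : mul (mul a b) c = mul a (mul b c) := by
  induction a with
  | letter i => rfl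
  | bar v => rfl
  | letterMul i v ih => simp only [mul, ih]
  | barMul v v' _ ih => simp only [mul, ih]

instance : UnarySemigroup UWord where
  mul := mul
  mul_assoc := mul_assoc'
  bar := bar

/-- The value of a unary word under an assignment of the letters. -/
def eval {S : Type v} [UnarySemigroup S] (φ : ℕ → S) : UWord → S
  | letter i => φ i
  | bar w => UnarySemigroup.bar (eval φ w)
  | letterMul i w => φ i * eval φ w
  | barMul v w => UnarySemigroup.bar (eval φ v) * eval φ w

theorem eval_mul {S : Type v} [UnarySemigroup S] (φ : ℕ → S) (a b : UWord) :
    eval φ (a * b) = eval φ a * eval φ b := by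
  change eval φ (mul a b) = _
  induction a with
  | letter i => rfl
  | bar v => rfl
  | letterMul i v ih => simp only [mul, eval, ih, mul_assoc]
  | barMul v v' _ ih => simp only [mul, eval, ih, mul_assoc]

/-- The set of letters that occur in a unary word. -/
def content : UWord → Finset ℕ
  | letter i => {i}
  | bar w => content w
  | letterMul i w => insert i (content w)
  | barMul v w => content v ∪ content w

/-- Renaming of the letters of a unary word. -/
def rename (f : ℕ → ℕ) : UWord → UWord
  | letter i => letter (f i)
  | bar w => bar (rename f w)
  | letterMul i w => letterMul (f i) (rename f w)
  | barMul v w => barMul (rename f v) (rename f w)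

theorem eval_rename {S : Type v} [UnarySemigroup S] (φ : ℕ → S) (f : ℕ → ℕ) (w : UWord) :
    eval φ (rename f w) = eval (φ ∘ f) w := by
  induction w with
  | letter i => rfl
  | bar v ih => simp only [rename, eval, ih]
  | letterMul i v ih => simp only [rename, eval, ih, Function.comp]
  | barMul v v' ih ih' => simp only [rename, eval, ih, ih']

/-- A semigroup word, regarded as a unary word. -/
def ofSWord (w : SWord) : UWord := SWord.eval letter w

end UWord

/-! ### The lattice of semigroup varieties -/

/-- A semigroup satisfies an identity. -/
def SemigroupModel.Satisfies (S : SemigroupModel.{u}) (i : SWord × SWord) : Prop :=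
  ∀ φ : ℕ → S.carrier, SWord.eval φ i.1 = SWord.eval φ i.2

/-- The lattice of all semigroup varieties. A variety is the class (`extent`) of all semigroups that
satisfy some set of identities; it is stored together with the set (`intent`) of all identities
that hold in it. The order is inclusion of classes. -/
abbrev SemigroupVariety : Type (u + 1) :=
  Concept SemigroupModel.{u} (SWord × SWord) SemigroupModel.Satisfies

namespace SemigroupVariety

/-- The variety of all semigroups that satisfy the identities in `I`. -/
def ofIdentities (I : Set (SWord × SWord)) : SemigroupVariety.{u} :=
  Concept.ofAttributes SemigroupModel.Satisfies I

/-- The trivial variety, given by `x ≈ y`. -/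
def trivialVariety : SemigroupVariety.{u} :=
  ofIdentities {(FreeSemigroup.of 0, FreeSemigroup.of 1)}

/-- The variety of semilattices, given by `x x ≈ x` and `x y ≈ y x`. -/
def semilattices : SemigroupVariety.{u} :=
  ofIdentities {(FreeSemigroup.of 0 * FreeSemigroup.of 0, FreeSemigroup.of 0),
    (FreeSemigroup.of 0 * FreeSemigroup.of 1, FreeSemigroup.of 1 * FreeSemigroup.of 0)}

/-- The identity `u ≈ v` holds in `V`. -/
def Holds (V : SemigroupVariety.{u}) (u v : SWord) : Prop :=
  ∀ S ∈ V.extent, S.Satisfies (u, v)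

/-- The identity `w ≈ 0` holds in `V`, that is, `w x ≈ x w ≈ w` holds for letters `x` not in `w`. -/
def HoldsZero (V : SemigroupVariety.{u}) (w : SWord) : Prop :=
  ∀ x ∉ w.content, V.Holds (w * FreeSemigroup.of x) w ∧ V.Holds (FreeSemigroup.of x * w) w

/-- `V` consists of nilsemigroups. -/
def IsNil (V : SemigroupVariety.{u}) : Prop :=
  ∀ S ∈ V.extent, IsNilsemigroup S.carrier

/-- The `V`-stabilizer of a word `u`: the group of all permutations `σ` of the letters of `u` such
that `u ≈ σ(u)` holds in `V`. -/
def stab (V : SemigroupVariety.{u}) (u : SWord) : Subgroup (Equiv.Perm u.content) where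
  carrier := {σ | V.Holds u (u.rename (Equiv.Perm.ofSubtype σ))}
  one_mem' := by
    intro S _ φ
    change _ = SWord.eval φ (SWord.rename _ u)
    rw [SWord.eval_rename, map_one]
    rfl
  mul_mem' := by
    intro σ τ hσ hτ S hS φ
    have h1 := hσ S hS φ
    have h2 := hτ S hS (φ ∘ Equiv.Perm.ofSubtype σ)
    change _ = SWord.eval _ (SWord.rename _ u) at h1
    change _ = SWord.eval _ (SWord.rename _ u) at h2
    change _ = SWord.eval φ (SWord.rename _ u)
    rw [SWord.eval_rename] at h1 h2 ⊢
    rw [map_mul]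
    exact h1.trans h2
  inv_mem' := by
    intro σ hσ S hS φ
    have h1 := hσ S hS (φ ∘ Equiv.Perm.ofSubtype σ⁻¹)
    change _ = SWord.eval _ (SWord.rename _ u) at h1
    change _ = SWord.eval φ (SWord.rename _ u)
    rw [SWord.eval_rename] at h1 ⊢
    rw [h1, Function.comp_assoc, ← Equiv.Perm.coe_mul, ← map_mul, inv_mul_cancel, map_one]
    rfl

end SemigroupVariety

/-! ### The lattice of epigroup varieties -/

/-- A unary semigroup satisfies an identity. -/
def UnaryModel.Satisfies (S : UnaryModel.{u}) (i : UWord × UWord) : Prop :=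
  ∀ φ : ℕ → S.carrier, UWord.eval φ i.1 = UWord.eval φ i.2

/-- The lattice of all varieties of unary semigroups: classes (`extent`) given by sets of
identities, ordered by inclusion. -/
abbrev UnaryVariety : Type (u + 1) :=
  Concept UnaryModel.{u} (UWord × UWord) UnaryModel.Satisfies

section EpigroupIdentities

variable {S : Type v}

theorem posPow_succ' [Semigroup S] (a : S) (n : ℕ) : posPow a (n + 1) = a * posPow a n := by
  induction n with
  | zero => rfl
  | succ n ih =>
    change posPow a (n + 1) * a = a * (posPow a n * a)
    rw [ih, mul_assoc]

/-- The equational properties of the pseudoinverse. -/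
theorem IsPseudoinverse.equations [Semigroup S] {x y : S} (h : IsPseudoinverse x y) :
    x * y = y * x ∧ y * x * y = y ∧ ∃ n, posPow x n * (x * y) = posPow x n := by
  obtain ⟨e, -, ⟨n, ⟨h1, h2⟩, b, ⟨-, -⟩, h5, h6⟩, ⟨⟨h7, h8⟩, -⟩, h9, h10⟩ := h
  have hxe : x * e = e * x := by
    have a1 : x * e = posPow x (n + 1) * b := by
      rw [posPow_succ', mul_assoc, h5]
    have a2 : e * x = b * posPow x (n + 1) := by
      rw [← h6, mul_assoc]
      rfl
    have a3 : posPow x (n + 1) = posPow x (n + 1) * e := by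
      rw [posPow_succ', mul_assoc, h2]
    have a4 : e * posPow x (n + 1) = posPow x (n + 1) := by
      change e * (posPow x n * x) = posPow x n * x
      rw [← mul_assoc, h1]
    have a5 : posPow x (n + 1) * posPow x n = posPow x n * posPow x (n + 1) := by
      change posPow x n * x * posPow x n = _
      rw [mul_assoc, ← posPow_succ']
    rw [a1, a2]
    conv_rhs => rw [a3, ← h5, ← mul_assoc (posPow x (n + 1)), a5, mul_assoc (posPow x n),
      ← mul_assoc b, h6, ← mul_assoc, a4]
  have hxy : x * y = e := by rw [← h9, mul_assoc, h7]
  have hyx : y * x = e := by rw [← h10, hxe, ← mul_assoc, h8]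
  exact ⟨hxy.trans hyx.symm, by rw [hyx, h7], n, by rw [hxy, h2]⟩

theorem posPow_mul_of_le [Semigroup S] {x y : S} {n m : ℕ} (hnm : n ≤ m)
    (h : posPow x n * (x * y) = posPow x n) : posPow x m * (x * y) = posPow x m := by
  induction m, hnm using Nat.le_induction with
  | base => exact h
  | succ m _ ih => rw [posPow_succ', mul_assoc, ih]

theorem isPseudoinverse_of_equations [Semigroup S] {x y : S} (h1 : x * y = y * x)
    (h2 : y * x * y = y) {n : ℕ} (h3 : posPow x n * (x * y) = posPow x n) :
    IsPseudoinverse x y := by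
  have ee : x * y * (x * y) = x * y := by
    rw [mul_assoc, ← mul_assoc y, h2]
  have ey : x * y * y = y := by rw [h1, h2]
  have ye : y * (x * y) = y := by rw [← mul_assoc, h2]
  have cm : Commute x y := h1
  have cp : ∀ k l, Commute (posPow x k) (posPow y l) := by
    intro k l
    have c1 : ∀ k, Commute (posPow x k) y := by
      intro k
      induction k with
      | zero => exact cm
      | succ k ih => exact ih.mul_left cm
    induction l with
    | zero => exact c1 k
    | succ l ih => exact ih.mul_right (c1 k)
  have pe : ∀ k, posPow x k * posPow y k = x * y := by
    intro k
    induction k with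
    | zero => rfl
    | succ k ih =>
      have : posPow x (k + 1) * posPow y (k + 1) = x * (posPow x k * posPow y k) * y := by
        rw [posPow_succ']
        change x * posPow x k * (posPow y k * y) = _
        simp only [mul_assoc]
      rw [this, ih, mul_assoc, ey]
  have yl : ∀ k, x * y * posPow y k = posPow y k := by
    intro k
    induction k with
    | zero => exact ey
    | succ k ih =>
      change x * y * (posPow y k * y) = posPow y k * y
      rw [← mul_assoc, ih]
  have yr : ∀ k, posPow y k * (x * y) = posPow y k := by
    intro k
    induction k with
    | zero => exact ye
    | succ k ih => rw [posPow_succ', mul_assoc, ih]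
  have xl : x * y * posPow x n = posPow x n := by
    have c : Commute (posPow x n) (x * y) := by
      have c0 : ∀ k, Commute (posPow x k) x := by
        intro k
        induction k with
        | zero => exact Commute.refl x
        | succ k ih => exact ih.mul_left (Commute.refl x)
      exact (c0 n).mul_right (cp n 0)
    rw [← c.eq, h3]
  have xey : x * (x * y) * y = x * y := by rw [mul_assoc, ey]
  refine ⟨x * y, ee, ⟨n, ⟨xl, h3⟩, posPow y n, ⟨yl n, yr n⟩, pe n, ?_⟩,
    ⟨⟨ey, ye⟩, x * (x * y), ⟨?_, ?_⟩, ?_, xey⟩, xey, ?_⟩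
  · rw [← (cp n n).eq, pe]
  · rw [← mul_assoc, mul_assoc x y x, ← h1, mul_assoc x (x * y), ee]
  · rw [mul_assoc, ee]
  · rw [← mul_assoc, ← h1, ee]
  · rw [← mul_assoc, ← h1, ee]

end EpigroupIdentities

namespace UnaryVariety

/-- The identity `x ^ (n + 1) x (bar x) ≈ x ^ (n + 1)`. -/
def indexIdentity (n : ℕ) : UWord × UWord :=
  (posPow (UWord.letter 0) n * (UWord.letter 0 * UWord.bar (UWord.letter 0)),
    posPow (UWord.letter 0) n)

theorem eval_posPow {S : Type v} [UnarySemigroup S] (φ : ℕ → S) (w : UWord) (n : ℕ) :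
    UWord.eval φ (posPow w n) = posPow (UWord.eval φ w) n := by
  induction n with
  | zero => rfl
  | succ n ih =>
    change UWord.eval φ (posPow w n * w) = _
    rw [UWord.eval_mul, ih]
    rfl

theorem satisfies_indexIdentity (S : UnaryModel.{u}) (n : ℕ) :
    S.Satisfies (indexIdentity n) ↔
      ∀ x : S.carrier, posPow x n * (x * UnarySemigroup.bar x) = posPow x n := by
  have key : ∀ φ : ℕ → S.carrier,
      (UWord.eval φ (indexIdentity n).1 = UWord.eval φ (indexIdentity n).2) ↔
        posPow (φ 0) n * (φ 0 * UnarySemigroup.bar (φ 0)) = posPow (φ 0) n := by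
    intro φ
    simp only [indexIdentity, UWord.eval_mul, eval_posPow, UWord.eval]
  exact ⟨fun h x => (key fun _ => x).1 (h _), fun h φ => (key φ).2 (h _)⟩

/-- Each variety that consists of epigroups satisfies one of the index identities. -/
theorem exists_index (V : UnaryVariety.{u}) (hV : ∀ S ∈ V.extent, IsEpigroup S.carrier) :
    ∃ n, ∀ S ∈ V.extent, S.Satisfies (indexIdentity n) := by
  by_contra hcon
  push Not at hcon
  choose S hS hn using hcon
  have hn' : ∀ n, ∃ x : (S n).carrier,
      posPow x n * (x * UnarySemigroup.bar x) ≠ posPow x n := by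
    intro n
    have := mt (satisfies_indexIdentity (S n) n).2 (hn n)
    push Not at this
    exact this
  choose x hx using hn'
  let str : UnarySemigroup (∀ n, (S n).carrier) :=
    { mul := fun a b n => a n * b n
      mul_assoc := fun a b c => funext fun n => mul_assoc (a n) (b n) (c n)
      bar := fun a n => UnarySemigroup.bar (a n) }
  let P : UnaryModel.{u} := { carrier := ∀ n, (S n).carrier }
  have hev : ∀ (φ : ℕ → P.carrier) (w : UWord) (n : ℕ),
      (UWord.eval φ w : P.carrier) n = UWord.eval (fun i => φ i n) w := by
    intro φ w n
    induction w with
    | letter i => rfl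
    | bar v ih => simp only [UWord.eval, ← ih]; rfl
    | letterMul i v ih => simp only [UWord.eval, ← ih]; rfl
    | barMul v v' ih ih' => simp only [UWord.eval, ← ih, ← ih']; rfl
  have hP : P ∈ V.extent := by
    rw [← V.lowerPolar_intent]
    intro i hi φ
    funext n
    rw [hev, hev]
    exact Concept.rel_extent_intent (hS n) hi _
  obtain ⟨-, -, n, h⟩ := (hV P hP x).equations
  have hpow : ∀ k, (posPow (x : P.carrier) k : P.carrier) n = posPow (x n) k := by
    intro k
    induction k with
    | zero => rfl
    | succ k ih =>
      change (posPow (x : P.carrier) k : P.carrier) n * x n = posPow (x n) k * x n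
      rw [ih]
  refine hx n ?_
  have := congrFun h n
  rw [← hpow n]
  exact this

/-- The join of two varieties that consist of epigroups consists of epigroups. -/
theorem sup_isEpigroup (V W : UnaryVariety.{u}) (hV : ∀ S ∈ V.extent, IsEpigroup S.carrier)
    (hW : ∀ S ∈ W.extent, IsEpigroup S.carrier) :
    ∀ S ∈ (V ⊔ W).extent, IsEpigroup S.carrier := by
  intro S hS x
  obtain ⟨n, hn⟩ := exists_index V hV
  obtain ⟨m, hm⟩ := exists_index W hW
  have sat : ∀ i : UWord × UWord, (∀ T ∈ V.extent, T.Satisfies i) →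
      (∀ T ∈ W.extent, T.Satisfies i) → S.Satisfies i := by
    intro i h1 h2
    refine Concept.rel_extent_intent hS ?_
    rw [Concept.intent_sup, ← V.upperPolar_extent, ← W.upperPolar_extent]
    exact ⟨fun T hT => h1 T hT, fun T hT => h2 T hT⟩
  have e1 := sat (UWord.letter 0 * UWord.bar (UWord.letter 0),
      UWord.bar (UWord.letter 0) * UWord.letter 0)
    (fun T hT φ => (hV T hT (φ 0)).equations.1) (fun T hT φ => (hW T hT (φ 0)).equations.1)
    fun _ => x
  have e2 := sat (UWord.bar (UWord.letter 0) * UWord.letter 0 * UWord.bar (UWord.letter 0),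
      UWord.bar (UWord.letter 0))
    (fun T hT φ => by
      simp only [UWord.eval_mul]
      exact (hV T hT (φ 0)).equations.2.1)
    (fun T hT φ => by
      simp only [UWord.eval_mul]
      exact (hW T hT (φ 0)).equations.2.1)
    fun _ => x
  simp only [UWord.eval_mul] at e2
  have e3 := (satisfies_indexIdentity S (max n m)).1 (sat (indexIdentity (max n m))
    (fun T hT => (satisfies_indexIdentity T _).2 fun y =>
      posPow_mul_of_le (le_max_left n m)
        ((satisfies_indexIdentity T n).1 (hn T hT) y))
    (fun T hT => (satisfies_indexIdentity T _).2 fun y =>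
      posPow_mul_of_le (le_max_right n m)
        ((satisfies_indexIdentity T m).1 (hm T hT) y))) x
  exact isPseudoinverse_of_equations e1 e2 e3

end UnaryVariety

/-- The lattice of all epigroup varieties, as a sublattice of the lattice of all varieties of unary
semigroups: a variety of epigroups is a variety of unary semigroups all members of which are
epigroups with pseudoinversion as the unary operation. -/
def epigroupVarieties : Sublattice UnaryVariety.{u} where
  carrier := {V | ∀ S ∈ V.extent, IsEpigroup S.carrier}
  supClosed' := fun V hV W hW => UnaryVariety.sup_isEpigroup V W hV hW
  infClosed' := fun V hV W _ S hS => hV S (by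
    rw [Concept.extent_inf] at hS
    exact hS.1)

/-- The lattice of all epigroup varieties. -/
abbrev EpigroupVariety : Type (u + 1) := epigroupVarieties.{u}

namespace EpigroupVariety

/-- The trivial variety, given by `x ≈ y`. -/
def trivialVariety : EpigroupVariety.{u} :=
  ⟨Concept.ofAttributes UnaryModel.Satisfies {(UWord.letter 0, UWord.letter 1)}, by
    intro S hS x
    have h : ∀ a b : S.carrier, a = b := fun a b =>
      hS (Set.mem_singleton _) fun i => if i = 0 then a else b
    exact ⟨x, h _ _, ⟨0, ⟨h _ _, h _ _⟩, x, ⟨h _ _, h _ _⟩, h _ _, h _ _⟩,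
      ⟨⟨h _ _, h _ _⟩, x, ⟨h _ _, h _ _⟩, h _ _, h _ _⟩, h _ _, h _ _⟩⟩

/-- The variety of semilattices, given by `x x ≈ x` and `x y ≈ y x`, together with `bar x ≈ x`
(which says that the unary operation of a semilattice is pseudoinversion). -/
def semilattices : EpigroupVariety.{u} :=
  ⟨Concept.ofAttributes UnaryModel.Satisfies
    {(UWord.letter 0 * UWord.letter 0, UWord.letter 0),
      (UWord.letter 0 * UWord.letter 1, UWord.letter 1 * UWord.letter 0),
      (UWord.bar (UWord.letter 0), UWord.letter 0)}, by
    intro S hS x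
    have h1 : x * x = x := hS (Or.inl rfl) fun _ => x
    have h2 : UnarySemigroup.bar x = x := hS (Or.inr (Or.inr rfl)) fun _ => x
    have hx : x ∈ maximalSubgroup x := ⟨⟨h1, h1⟩, x, ⟨h1, h1⟩, h1, h1⟩
    rw [h2]
    exact ⟨x, h1, ⟨0, hx⟩, hx, by rw [h1, h1], by rw [h1, h1]⟩⟩

/-- The identity `u ≈ v` holds in `V`. -/
def Holds (V : EpigroupVariety.{u}) (u v : UWord) : Prop :=
  ∀ S ∈ V.1.extent, S.Satisfies (u, v)

/-- The identity `w ≈ 0` holds in `V`, that is, `w x ≈ x w ≈ w` holds for letters `x` not in `w`. -/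
def HoldsZero (V : EpigroupVariety.{u}) (w : UWord) : Prop :=
  ∀ x ∉ w.content, V.Holds (w * UWord.letter x) w ∧ V.Holds (UWord.letter x * w) w

/-- `V` consists of nilsemigroups. -/
def IsNil (V : EpigroupVariety.{u}) : Prop :=
  ∀ S ∈ V.1.extent, IsNilsemigroup S.carrier

/-- The `V`-stabilizer of a word `u`: the group of all permutations `σ` of the letters of `u` such
that `u ≈ σ(u)` holds in `V`. -/
def stab (V : EpigroupVariety.{u}) (u : UWord) : Subgroup (Equiv.Perm u.content) where
  carrier := {σ | V.Holds u (u.rename (Equiv.Perm.ofSubtype σ))}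
  one_mem' := by
    intro S _ φ
    change _ = UWord.eval φ (UWord.rename _ u)
    rw [UWord.eval_rename, map_one]
    rfl
  mul_mem' := by
    intro σ τ hσ hτ S hS φ
    have h1 := hσ S hS φ
    have h2 := hτ S hS (φ ∘ Equiv.Perm.ofSubtype σ)
    change _ = UWord.eval _ (UWord.rename _ u) at h1
    change _ = UWord.eval _ (UWord.rename _ u) at h2
    change _ = UWord.eval φ (UWord.rename _ u)
    rw [UWord.eval_rename] at h1 h2 ⊢
    rw [map_mul]
    exact h1.trans h2
  inv_mem' := by
    intro σ hσ S hS φ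
    have h1 := hσ S hS (φ ∘ Equiv.Perm.ofSubtype σ⁻¹)
    change _ = UWord.eval _ (UWord.rename _ u) at h1
    change _ = UWord.eval φ (UWord.rename _ u)
    rw [UWord.eval_rename] at h1 ⊢
    rw [h1, Function.comp_assoc, ← Equiv.Perm.coe_mul, ← map_mul, inv_mul_cancel, map_one]
    rfl

end EpigroupVariety

/-! ### The conditions on a variety -/

/-- The identity `u ≈ v` between semigroup words is substitutive: both sides have the same letters
and `v` is obtained from `u` by renaming letters. -/
def SWord.IsSubstitutive (u v : SWord) : Prop :=
  u.content = v.content ∧ ∃ σ : Equiv.Perm ℕ, v = u.rename σ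

/-- The identity `u ≈ v` between unary words is substitutive. -/
def UWord.IsSubstitutive (u v : UWord) : Prop :=
  u.content = v.content ∧ ∃ σ : Equiv.Perm ℕ, v = u.rename σ

section Subgroups

variable {X : Type} [Fintype X] [DecidableEq X] {Y : Type} [Fintype Y] [DecidableEq Y]

/-- `X` has three elements and `H` is one of the groups `T₁₂`, `T₁₃`, `T₂₃`, that is, `H` is
generated by a transposition. -/
def IsTranspositionGroup (H : Subgroup (Equiv.Perm X)) : Prop :=
  Fintype.card X = 3 ∧ ∃ i j : X, i ≠ j ∧ H = Subgroup.closure {Equiv.swap i j}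

/-- `X` has `n` elements and `H` is the alternating group. -/
def IsAlternatingGroup (n : ℕ) (H : Subgroup (Equiv.Perm X)) : Prop :=
  Fintype.card X = n ∧ H = alternatingGroup X

/-- `X` has four elements and `H` is one of the three dihedral groups of order `8`, that is, for some
enumeration `i, j, s, t` of `X`, the group `H` is generated by `(i j)`, `(s t)` and
`(i s)(j t)`. -/
def IsDihedralGroup (H : Subgroup (Equiv.Perm X)) : Prop :=
  Fintype.card X = 4 ∧ ∃ i j s t : X, [i, j, s, t].Nodup ∧
    H = Subgroup.closure
      {Equiv.swap i j, Equiv.swap s t, Equiv.swap i s * Equiv.swap j t}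

/-- The pairs of subgroups that are forbidden as stabilizers of a pair of words. -/
def IsForbiddenPair (H : Subgroup (Equiv.Perm X)) (K : Subgroup (Equiv.Perm Y)) : Prop :=
  (IsTranspositionGroup H ∧ IsTranspositionGroup K) ∨
  (IsTranspositionGroup H ∧ IsAlternatingGroup 3 K) ∨
  (IsDihedralGroup H ∧ IsDihedralGroup K) ∨
  (IsDihedralGroup H ∧ IsAlternatingGroup 4 K)

end Subgroups

namespace SemigroupVariety

/-- If a non-substitutive identity `u ≈ v` holds in `V`, then so do `u ≈ 0` and `v ≈ 0`. -/
def ConditionA (V : SemigroupVariety.{u}) : Prop :=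
  ∀ u v : SWord, V.Holds u v → ¬ u.IsSubstitutive v → V.HoldsZero u ∧ V.HoldsZero v

/-- If `u ≈ 0` does not hold in `V`, then the `V`-stabilizer of `u` is a modular element of the
subgroup lattice of the symmetric group on the letters of `u`. -/
def ConditionB (V : SemigroupVariety.{u}) : Prop :=
  ∀ u : SWord, ¬ V.HoldsZero u → IsModularElement (V.stab u)

/-- No two non-equivalent words with the same letters have a forbidden pair of stabilizers. -/
def ConditionC' (V : SemigroupVariety.{u}) : Prop :=
  ¬ ∃ u v : SWord, ¬ u.Equivalent v ∧ u.content = v.content ∧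
    IsForbiddenPair (V.stab u) (V.stab v)

end SemigroupVariety

namespace EpigroupVariety

/-- If a non-substitutive identity `u ≈ v` holds in `V`, then so do `u ≈ 0` and `v ≈ 0`. -/
def ConditionA (V : EpigroupVariety.{u}) : Prop :=
  ∀ u v : UWord, V.Holds u v → ¬ u.IsSubstitutive v → V.HoldsZero u ∧ V.HoldsZero v

/-- If `u ≈ 0` does not hold in `V`, then the `V`-stabilizer of `u` is a modular element of the
subgroup lattice of the symmetric group on the letters of `u`. -/
def ConditionB (V : EpigroupVariety.{u}) : Prop :=
  ∀ u : UWord, ¬ V.HoldsZero u → IsModularElement (V.stab u)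

/-- No two non-equivalent semigroup words with the same letters have a forbidden pair of
stabilizers. -/
def ConditionC' (V : EpigroupVariety.{u}) : Prop :=
  ¬ ∃ u v : SWord, ¬ u.Equivalent v ∧ u.content = v.content ∧
    IsForbiddenPair (V.stab (UWord.ofSWord u)) (V.stab (UWord.ofSWord v))

end EpigroupVariety

/-!
Passing to identities turns the lattice of varieties upside down: a variety corresponds to a fully
invariant congruence on the free algebra, and modularity of an element is a self-dual condition.
With `α` the congruence of `M ⊔ N` and `γ ≤ β` arbitrary, a pair `(u, v)` in `β` that is joined by a
chain of `α`- and `γ`-steps has to be joined by a chain of `(α ⊓ β)`- and `γ`-steps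
(`Concept.sup_inf_eq_of_join`, `WordAlgebra.join_inf_of_join`).

By `ConditionA`, the congruence `ν` of `N` collapses the ideal `I` of zero words to one class, and
outside `I` it only permutes letters. Pulling all permutations along the chain back to its first
word leaves two possibilities (`WordAlgebra.exists_zero_or_exists_permute`).

* Some `γ`-step pulls back to a word in `I` or changes the set of letters; in the latter case,
  substituting a zero word for a letter that occurs on one side only leads to a word in `I` as well.
  Then `u` and `v` are `γ`-congruent to words `i` and `j` in `I`, and these are linked by a single
  step of `α ⊓ β` if they have the same letters or if `M` is trivial. If `M` is the variety of
  semilattices and the letters of `i` and `j` differ, then `γ` does not preserve contents, and `i`,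
  `j` can be replaced by zero words whose letters are those of both
  (`WordAlgebra.exists_join_content_union`).
* The chain consists of words `σ b` with `b` in the `γ`-class of `u` and with the same letters. Then
  the claim is about subgroups of a finite symmetric group: with `A b`, `B`, `C` the stabilizers of
  `b` modulo `ν` and of `u` modulo `β` and `γ`, the intersection of `B` with the join of all `A b`
  lies in `(A b ⊓ B) ⊔ C` for one `b` (`WordAlgebra.inf_iSup_le_of_modular`). As each `A b` is
  modular by `ConditionB`, it suffices that the subgroups `A b ⊔ C` form a chain. Two modular
  subgroups of a finite symmetric group are comparable or form one of the pairs forbidden in `ConditionC'`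
  (`IsModularElement.le_or_le_or_isForbiddenPair`). In the second case `ConditionC'` makes the words
  equivalent, so they differ by a permutation of letters, which belongs to `C`; hence the two
  subgroups are conjugate by an element of `C` and have the same join with `C`.

In the classification of modular subgroups the tool is that a modular `H` contains, for `h ∈ H` and
any `t` such that `h * t * h⁻¹` is not a power of `t`, an element of the subgroup generated by these
two that is not a power of `t`. Taking `t` a transposition or a product of two shows that `H` is
trivial, the Klein four-group on four points, the alternating group, the symmetric group, or else
generated by a transposition on three points or dihedral on four.
-/

/-! ### Modular elements of the subgroup lattice of a finite symmetric group -/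

section ModularSubgroups

open Equiv Equiv.Perm

/-- If `H` is modular, `h ∈ H`, and the conjugate of `t` by `h` is not a power of `t`, then the
subgroup generated by `t` and this conjugate meets `H` outside the powers of `t`: it has
the same join with `H` as the subgroup of these powers. -/
theorem IsModularElement.exists_mem_closure_conj {G : Type*} [Group G] {H : Subgroup G}
    (hH : IsModularElement H) {h t : G} (hh : h ∈ H)
    (ht : h * t * h⁻¹ ∉ Subgroup.zpowers t) :
    ∃ g ∈ H, g ∈ Subgroup.closure {t, h * t * h⁻¹} ∧ g ∉ Subgroup.zpowers t := by
  by_contra! hcon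
  have hz : Subgroup.zpowers t ≤ Subgroup.closure {t, h * t * h⁻¹} := by
    rw [Subgroup.zpowers_le]
    exact Subgroup.subset_closure (Or.inl rfl)
  have hle : H ⊓ Subgroup.closure {t, h * t * h⁻¹} ≤ Subgroup.zpowers t :=
    fun g hg => hcon g hg.1 hg.2
  have hmod := hH _ _ hz
  rw [sup_eq_right.2 hle] at hmod
  refine ht (hmod ▸ ⟨?_, Subgroup.subset_closure (Or.inr rfl)⟩)
  have h1 : h ∈ H ⊔ Subgroup.zpowers t := Subgroup.mem_sup_left hh
  have h2 : t ∈ H ⊔ Subgroup.zpowers t := Subgroup.mem_sup_right (Subgroup.mem_zpowers t)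
  exact mul_mem (mul_mem h1 h2) ((H ⊔ Subgroup.zpowers t).inv_mem h1)

theorem mem_closure_pair_of_commuting_involutions {G : Type*} [Group G] {s t g : G}
    (hs : s * s = 1) (ht : t * t = 1) (hc : s * t = t * s) (hg : g ∈ Subgroup.closure {s, t}) :
    g = 1 ∨ g = s ∨ g = t ∨ g = s * t := by
  have hs' : ∀ x, s * (s * x) = x := fun x => by rw [← mul_assoc, hs, one_mul]
  have hc' : ∀ x, t * (s * x) = s * (t * x) := fun x => by
    rw [← mul_assoc, ← hc, mul_assoc]
  induction hg using Subgroup.closure_induction with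
  | mem x hx => rcases hx with rfl | rfl <;> simp
  | one => exact Or.inl rfl
  | mul x y _ _ hx hy =>
    rcases hx with rfl | rfl | rfl | rfl <;> rcases hy with rfl | rfl | rfl | rfl <;>
      simp [mul_assoc, hs, ht, hs', hc', ← hc]
  | inv x _ hx =>
    have hsi : s⁻¹ = s := inv_eq_of_mul_eq_one_left hs
    have hti : t⁻¹ = t := inv_eq_of_mul_eq_one_left ht
    rcases hx with rfl | rfl | rfl | rfl <;> simp [hsi, hti, hc]

/-- A modular subgroup contains the commutator `t * (h * t * h⁻¹)` of `h ∈ H` with an involution `t`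
that commutes with its conjugate. -/
theorem IsModularElement.mul_conj_mem {G : Type*} [Group G] {H : Subgroup G}
    (hH : IsModularElement H) {h t : G} (hh : h ∈ H) (ht : t * t = 1)
    (hc : t * (h * t * h⁻¹) = h * t * h⁻¹ * t) : t * (h * t * h⁻¹) ∈ H := by
  by_cases hz : h * t * h⁻¹ ∈ Subgroup.zpowers t
  · have hsub : (h * t * h⁻¹ = 1) ∨ h * t * h⁻¹ = t := by
      have := Subgroup.zpowers_eq_closure t ▸ hz
      have := mem_closure_pair_of_commuting_involutions ht ht rfl
        (Subgroup.closure_mono (by simp : ({t} : Set G) ⊆ {t, t}) this)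
      simpa [ht, or_comm, or_left_comm] using this
    rcases hsub with h1 | h1
    · have : t = 1 := by simpa using h1
      simp [this, one_mem]
    · rw [h1, ht]
      exact one_mem H
  · obtain ⟨g, hg, hg1, hg2⟩ := hH.exists_mem_closure_conj hh hz
    have hconj : h * t * h⁻¹ * (h * t * h⁻¹) = 1 := by
      simp only [mul_assoc, inv_mul_cancel_left]
      rw [← mul_assoc t t, ht]
      simp
    rcases mem_closure_pair_of_commuting_involutions ht hconj hc hg1 with rfl | rfl | rfl | rfl
    · exact absurd (one_mem _) hg2
    · exact absurd (Subgroup.mem_zpowers _) hg2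
    · have : t ∈ H := by
        have := mul_mem (mul_mem (inv_mem hh) hg) hh
        simpa [mul_assoc] using this
      exact mul_mem this hg
    · exact hg

variable {X : Type}

theorem apply_eq_of_mem_closure {S : Set (Perm X)} {g : Perm X} {x : X}
    (hS : ∀ s ∈ S, s x = x) (hg : g ∈ Subgroup.closure S) : g x = x := by
  induction hg using Subgroup.closure_induction with
  | mem s hs => exact hS s hs
  | one => rfl
  | mul s t _ _ hs ht => rw [Perm.mul_apply, ht, hs]
  | inv s _ hs => rw [Perm.inv_eq_iff_eq, hs]

variable [DecidableEq X] {H K : Subgroup (Perm X)}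

/-- The subgroup `H` contains a transposition. -/
def HasSwap (H : Subgroup (Perm X)) : Prop := ∃ a b, a ≠ b ∧ swap a b ∈ H

theorem swap_mem_trans {a b c : X} (hac : a ≠ c) (h1 : swap a b ∈ H) (h2 : swap b c ∈ H) :
    swap a c ∈ H := by
  rcases eq_or_ne a b with rfl | hab
  · exact h2
  have := swap_mul_swap_mul_swap (x := b) (y := c) (z := a)
  rcases eq_or_ne b c with rfl | hbc
  · exact h1
  have h3 := mul_mem (mul_mem h1 h2) (inv_mem h1)
  rw [← swap_apply_apply] at h3
  simpa [swap_apply_of_ne_of_ne hac.symm hbc.symm] using h3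

theorem swap_conj_mem {g : Perm X} (hg : g ∈ H) {a b : X} (h : swap a b ∈ H) :
    swap (g a) (g b) ∈ H := by
  rw [swap_apply_apply]
  exact mul_mem (mul_mem hg h) (inv_mem hg)

/-- A modular subgroup that contains one transposition contains all transpositions disjoint
from it. -/
theorem IsModularElement.swap_mem_of_disjoint (hH : IsModularElement H) {a b c d : X}
    (hab : swap a b ∈ H) (hnd : [a, b, c, d].Nodup) : swap c d ∈ H := by
  simp only [List.nodup_cons, List.mem_cons, List.not_mem_nil, or_false, not_or] at hnd
  obtain ⟨⟨h1, h2, h3⟩, ⟨h4, h5⟩, h6, -⟩ := hnd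
  -- Conjugation by `swap a b` interchanges two elements of the Klein four-group, whose product is
  -- the third one.
  have key : swap a b * (swap c a * swap b d) * (swap a b)⁻¹ = swap c b * swap a d := by
    have : swap a b * (swap c a * swap b d) * (swap a b)⁻¹ =
        (swap a b * swap c a * (swap a b)⁻¹) * (swap a b * swap b d * (swap a b)⁻¹) := by group
    rw [this, ← swap_apply_apply, ← swap_apply_apply]
    simp [swap_apply_of_ne_of_ne (Ne.symm h2) (Ne.symm h4),
      swap_apply_of_ne_of_ne (Ne.symm h3) (Ne.symm h5)]
  have e1 : swap c a * swap b d * (swap c b * swap a d) = swap a b * swap c d := by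
    ext x
    simp only [Perm.mul_apply, swap_apply_def]
    grind
  have e2 : swap c b * swap a d * (swap c a * swap b d) = swap a b * swap c d := by
    ext x
    simp only [Perm.mul_apply, swap_apply_def]
    grind
  have e3 : swap c a * swap b d * (swap c a * swap b d) = 1 := by
    ext x
    simp only [Perm.mul_apply, swap_apply_def, Perm.one_apply]
    grind
  have := hH.mul_conj_mem hab (t := swap c a * swap b d) e3 (by rw [key, e1, e2])
  rw [key, e1] at this
  simpa [← mul_assoc] using mul_mem hab this

/-- On four points, double transpositions are products of any two others. -/
theorem mem_of_double_swaps {a b c d : X} (hnd : [a, b, c, d].Nodup)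
    (hall : ∀ x, x = a ∨ x = b ∨ x = c ∨ x = d) (h1 : swap a b * swap c d ∈ H)
    (h2 : swap a c * swap b d ∈ H) {g : Perm X} (hg : ∀ x, g (g x) = x ∧ g x ≠ x) : g ∈ H := by
  simp only [List.nodup_cons, List.mem_cons, List.not_mem_nil, or_false, not_or] at hnd
  obtain ⟨⟨n1, n2, n3⟩, ⟨n4, n5⟩, n6, -⟩ := hnd
  have ga := hg a
  have gb := hg b
  have gc := hg c
  have gd := hg d
  rcases hall (g a) with h | h | h | h
  · exact absurd h ga.2
  · have : g = swap a b * swap c d := by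
      have hc := hall (g c)
      ext x
      simp only [Perm.mul_apply, swap_apply_def]
      rcases hall x with rfl | rfl | rfl | rfl <;> grind
    exact this ▸ h1
  · have : g = swap a c * swap b d := by
      have hc := hall (g b)
      ext x
      simp only [Perm.mul_apply, swap_apply_def]
      rcases hall x with rfl | rfl | rfl | rfl <;> grind
    exact this ▸ h2
  · have : g = swap a b * swap c d * (swap a c * swap b d) := by
      have hc := hall (g b)
      ext x
      simp only [Perm.mul_apply, swap_apply_def]
      rcases hall x with rfl | rfl | rfl | rfl <;> grind
    exact this ▸ mul_mem h1 h2

variable [Fintype X]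

theorem isSwap_or_isThreeCycle_of_support_subset {s : Finset X} (hs : s.card ≤ 3) {g : Perm X}
    (hg : g ≠ 1) (h : g.support ⊆ s) : g.IsSwap ∨ g.IsThreeCycle := by
  have h1 := Finset.card_le_card h
  have h2 := two_le_card_support_of_ne_one hg
  rcases (by omega : g.support.card = 2 ∨ g.support.card = 3) with h3 | h3
  · exact Or.inl (card_support_eq_two.1 h3)
  · exact Or.inr (card_support_eq_three_iff.1 h3)

/-- Conjugating a transposition by an element of a modular subgroup without moving more than three
points yields a transposition or a 3-cycle in the subgroup. -/
theorem IsModularElement.exists_small (hH : IsModularElement H) {h : Perm X} (hh : h ∈ H) {x y : X}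
    {s : Finset X} (hs : s.card ≤ 3) (hx : x ∈ s) (hy : y ∈ s) (hhx : h x ∈ s) (hhy : h y ∈ s)
    (hne : swap (h x) (h y) ≠ swap x y) (hxy : x ≠ y) :
    ∃ g ∈ H, g.support ⊆ s ∧ g ∉ Subgroup.zpowers (swap x y) ∧ (g.IsSwap ∨ g.IsThreeCycle) := by
  have hz : h * swap x y * h⁻¹ ∉ Subgroup.zpowers (swap x y) := by
    rw [← swap_apply_apply]
    intro hmem
    have := Subgroup.zpowers_eq_closure (swap x y) ▸ hmem
    have := mem_closure_pair_of_commuting_involutions (swap_mul_self x y) (swap_mul_self x y) rfl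
      (Subgroup.closure_mono (by simp : ({swap x y} : Set (Perm X)) ⊆ {swap x y, swap x y}) this)
    have h1 : swap (h x) (h y) ≠ 1 := by
      simpa [swap_eq_one_iff] using hxy
    simp [hne, h1] at this
  obtain ⟨g, hg, hg1, hg2⟩ := hH.exists_mem_closure_conj hh hz
  have hsup : g.support ⊆ s := by
    intro i hi
    by_contra his
    refine mem_support.1 hi (apply_eq_of_mem_closure ?_ hg1)
    rw [← swap_apply_apply]
    rintro t (rfl | rfl)
    · exact swap_apply_of_ne_of_ne (by rintro rfl; exact his hx) (by rintro rfl; exact his hy)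
    · exact swap_apply_of_ne_of_ne (by rintro rfl; exact his hhx) (by rintro rfl; exact his hhy)
  exact ⟨g, hg, hsup, hg2, isSwap_or_isThreeCycle_of_support_subset hs
    (by rintro rfl; exact hg2 (one_mem _)) hsup⟩

theorem eq_top_of_swap_mem (h : ∀ a b : X, a ≠ b → swap a b ∈ H) : H = ⊤ := by
  rw [eq_top_iff, ← closure_isSwap, Subgroup.closure_le]
  rintro _ ⟨a, b, hab, rfl⟩
  exact h a b hab

theorem IsModularElement.eq_top_of_hasSwap (hH : IsModularElement H) (h : HasSwap H)
    (hX : 5 ≤ Fintype.card X) : H = ⊤ := by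
  obtain ⟨a, b, hab, hmem⟩ := h
  have key : ∀ c, c ≠ a → swap a c ∈ H := by
    intro c hca
    rcases eq_or_ne c b with rfl | hcb
    · exact hmem
    have hcard : ({a, b, c} : Finset X).card ≤ 3 := Finset.card_le_three
    obtain ⟨d, hd⟩ := Finset.exists_mem_notMem_of_card_lt_card
      (s := {a, b, c}) (t := Finset.univ) (by rw [Finset.card_univ]; omega)
    have hcard : ({a, b, c, d} : Finset X).card ≤ 4 := Finset.card_le_four
    obtain ⟨e, he⟩ := Finset.exists_mem_notMem_of_card_lt_card
      (s := {a, b, c, d}) (t := Finset.univ) (by rw [Finset.card_univ]; omega)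
    simp only [Finset.mem_insert, Finset.mem_singleton, not_or] at hd he
    have h1 : swap d e ∈ H := hH.swap_mem_of_disjoint hmem (by simp; grind)
    exact hH.swap_mem_of_disjoint h1 (by simp; grind)
  refine eq_top_of_swap_mem fun x y hxy => ?_
  rcases eq_or_ne x a with rfl | hx
  · exact key y hxy.symm
  rcases eq_or_ne y a with rfl | hy
  · rw [swap_comm]
    exact key x hxy
  · exact swap_mem_trans hxy (swap_comm a x ▸ key x hx) (key y hy)

theorem exists_enumeration_of_card_eq_four (hX : Fintype.card X = 4) {a b : X} (hab : a ≠ b) :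
    ∃ c d, [a, b, c, d].Nodup ∧ ∀ x, x = a ∨ x = b ∨ x = c ∨ x = d := by
  have hcard : ({a, b} : Finset X).card ≤ 2 := Finset.card_le_two
  obtain ⟨c, -, hc⟩ := Finset.exists_mem_notMem_of_card_lt_card
    (s := {a, b}) (t := Finset.univ) (by rw [Finset.card_univ]; omega)
  have hcard : ({a, b, c} : Finset X).card ≤ 3 := Finset.card_le_three
  obtain ⟨d, -, hd⟩ := Finset.exists_mem_notMem_of_card_lt_card
    (s := {a, b, c}) (t := Finset.univ) (by rw [Finset.card_univ]; omega)
  simp only [Finset.mem_insert, Finset.mem_singleton, not_or] at hc hd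
  have hnd : [a, b, c, d].Nodup := by simp; grind
  refine ⟨c, d, hnd, fun x => ?_⟩
  have huniv : ({a, b, c, d} : Finset X) = Finset.univ := by
    rw [← Finset.card_eq_iff_eq_univ, hX]
    simpa using List.toFinset_card_of_nodup hnd
  have := Finset.mem_univ x
  rw [← huniv] at this
  simpa using this

/-- On four points, a modular subgroup with a transposition contains one of the dihedral groups. -/
theorem IsModularElement.mem_of_hasSwap_four (hH : IsModularElement H) (h : HasSwap H)
    (hX : Fintype.card X = 4) : ∃ a b c d, [a, b, c, d].Nodup ∧
      (∀ x, x = a ∨ x = b ∨ x = c ∨ x = d) ∧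
      swap a b ∈ H ∧ swap c d ∈ H ∧ swap a c * swap b d ∈ H := by
  obtain ⟨a, b, hab, hmem⟩ := h
  obtain ⟨c, d, hnd, hall⟩ := exists_enumeration_of_card_eq_four hX hab
  have hcd : swap c d ∈ H := hH.swap_mem_of_disjoint hmem hnd
  refine ⟨a, b, c, d, hnd, hall, hmem, hcd, ?_⟩
  simp only [List.nodup_cons, List.mem_cons, List.not_mem_nil, or_false, not_or] at hnd
  obtain ⟨⟨h1, h2, h3⟩, ⟨h4, h5⟩, h6, -⟩ := hnd
  -- The involution `swap a c` commutes with its conjugate `swap b d`.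
  have key : swap a b * swap c d * swap a c * (swap a b * swap c d)⁻¹ = swap b d := by
    rw [← swap_apply_apply]
    congr 1
    · simp [swap_apply_of_ne_of_ne h2 h3]
    · simp [swap_apply_of_ne_of_ne (Ne.symm h3) (Ne.symm h5)]
  have := hH.mul_conj_mem (mul_mem hmem hcd) (t := swap a c) (swap_mul_self a c) (by
    rw [key]
    ext x
    simp only [Perm.mul_apply, swap_apply_def]
    grind)
  rwa [key] at this

theorem IsModularElement.isDihedralGroup_of_hasSwap (hH : IsModularElement H) (h : HasSwap H)
    (hX : Fintype.card X = 4) (htop : H ≠ ⊤) : IsDihedralGroup H := by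
  obtain ⟨a, b, c, d, hnd, hall, hab, hcd, hv⟩ := hH.mem_of_hasSwap_four h hX
  refine ⟨hX, a, b, c, d, hnd, le_antisymm ?_ ?_⟩
  swap
  · rw [Subgroup.closure_le]
    rintro g (rfl | rfl | rfl) <;> assumption
  simp only [List.nodup_cons, List.mem_cons, List.not_mem_nil, or_false, not_or] at hnd
  obtain ⟨⟨h1, h2, h3⟩, ⟨h4, h5⟩, h6, -⟩ := hnd
  set D := Subgroup.closure {swap a b, swap c d, swap a c * swap b d}
  have da : swap a b ∈ D := Subgroup.subset_closure (by simp)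
  have dc : swap c d ∈ D := Subgroup.subset_closure (by simp)
  have dv : swap a c * swap b d ∈ D := Subgroup.subset_closure (by simp)
  -- A further transposition would connect the two blocks and generate everything.
  have hno : swap a c ∉ H := by
    intro hac
    refine htop (eq_top_of_swap_mem fun x y hxy => ?_)
    have key : ∀ x, swap a x ∈ H := by
      intro x
      rcases hall x with rfl | rfl | rfl | rfl
      · rw [swap_self]
        exact one_mem H
      · exact hab
      · exact hac
      · exact swap_mem_trans h3 hac hcd
    exact swap_mem_trans hxy (swap_comm a x ▸ key x) (key y)
  have hno' : ∀ x y, (x = a ∨ x = b) → (y = c ∨ y = d) → swap x y ∉ H := by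
    intro x y hx hy hxy
    apply hno
    have hay : swap a y ∈ H := by
      rcases hx with rfl | rfl
      · exact hxy
      · exact swap_mem_trans (by rcases hy with rfl | rfl <;> assumption) hab hxy
    rcases hy with rfl | rfl
    · exact hay
    · exact swap_mem_trans h2 hay (swap_comm c y ▸ hcd)
  -- Elements of `H` that fix `a` and `b` are powers of `swap c d`.
  have step1 : ∀ g ∈ H, g a = a → g b = b → g ∈ D := by
    intro g hg ga gb
    have hinj := g.injective
    by_cases gc : g c = c
    · have : g = 1 := by
        ext x
        rcases hall x with rfl | rfl | rfl | rfl
        · exact ga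
        · exact gb
        · exact gc
        · rcases hall (g x) with hx | hx | hx | hx <;> grind [Perm.one_apply]
      exact this ▸ one_mem D
    · have gc' : g c = d := by
        rcases hall (g c) with hx | hx | hx | hx <;> grind
      have gd : g d = c := by
        rcases hall (g d) with hx | hx | hx | hx <;> grind
      have : g = swap c d := by
        ext x
        simp only [swap_apply_def]
        rcases hall x with rfl | rfl | rfl | rfl <;> grind
      exact this ▸ dc
  have step2 : ∀ g ∈ H, (g a = a ∨ g a = b) → g ∈ D := by
    intro g hg ga
    have hinj := g.injective
    have hgb : g b = a ∨ g b = b := by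
      by_contra hcon
      have := swap_conj_mem hg hab
      exact hno' (g a) (g b) ga (by have := hall (g b); grind) this
    rcases ga with ga | ga
    · exact step1 g hg ga (by rcases hgb with hgb | hgb <;> grind)
    · have := step1 (swap a b * g) (mul_mem hab hg) (by simp [ga])
        (by
          rcases hgb with hgb | hgb
          · simp [hgb]
          · exact absurd (hinj (ga.trans hgb.symm)) h1)
      simpa [← mul_assoc] using mul_mem da this
  intro g hg
  by_cases ga : g a = a ∨ g a = b
  · exact step2 g hg ga
  · have hga : g a = c ∨ g a = d := by have := hall (g a); grind
    have := step2 (swap a c * swap b d * g) (mul_mem hv hg) (by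
      simp only [Perm.mul_apply, swap_apply_def]
      grind)
    have h7 := mul_mem (D.inv_mem dv) this
    rwa [inv_mul_cancel_left] at h7

theorem isTranspositionGroup_of_hasSwap (h : HasSwap H) (hX : Fintype.card X = 3)
    (htop : H ≠ ⊤) : IsTranspositionGroup H := by
  obtain ⟨a, b, hab, hmem⟩ := h
  refine ⟨hX, a, b, hab, le_antisymm (fun g hg => ?_) (by simpa using hmem)⟩
  have hcard : ({a, b} : Finset X).card ≤ 2 := Finset.card_le_two
  obtain ⟨c, -, hc⟩ := Finset.exists_mem_notMem_of_card_lt_card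
    (s := {a, b}) (t := Finset.univ) (by rw [Finset.card_univ]; omega)
  simp only [Finset.mem_insert, Finset.mem_singleton, not_or] at hc
  have hall : ∀ x, x = a ∨ x = b ∨ x = c := by
    intro x
    have huniv : ({a, b, c} : Finset X) = Finset.univ := by
      rw [← Finset.card_eq_iff_eq_univ, hX]
      simpa using List.toFinset_card_of_nodup (l := [a, b, c]) (by simp; grind)
    have := Finset.mem_univ x
    rw [← huniv] at this
    simpa using this
  have hno : swap a c ∉ H := by
    intro hac
    refine htop (eq_top_of_swap_mem fun x y hxy => ?_)
    have key : ∀ x, swap a x ∈ H := by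
      intro x
      rcases hall x with rfl | rfl | rfl
      · rw [swap_self]
        exact one_mem H
      · exact hmem
      · exact hac
    exact swap_mem_trans hxy (swap_comm a x ▸ key x) (key y)
  have hno' : swap b c ∉ H := fun hbc => hno (swap_mem_trans (Ne.symm hc.1) hmem hbc)
  have hinj := g.injective
  have gc : g c = c := by
    by_contra hgc
    have := swap_conj_mem hg hmem
    have ha := hall (g a)
    have hb := hall (g b)
    have hc' := hall (g c)
    have := swap_comm (g a) (g b)
    have : swap (g a) (g b) = swap a c ∨ swap (g a) (g b) = swap b c := by grind
    grind
  by_cases ga : g a = a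
  · have : g = 1 := by
      ext x
      rcases hall x with rfl | rfl | rfl
      · exact ga
      · rcases hall (g x) with hx | hx | hx <;> grind [Perm.one_apply]
      · exact gc
    exact this ▸ one_mem _
  · have : g = swap a b := by
      have ga' : g a = b := by rcases hall (g a) with hx | hx | hx <;> grind
      have gb' : g b = a := by rcases hall (g b) with hx | hx | hx <;> grind
      ext x
      simp only [swap_apply_def]
      rcases hall x with rfl | rfl | rfl <;> grind
    exact this ▸ Subgroup.subset_closure rfl

theorem Equiv.Perm.IsThreeCycle.exists_eq_swap_mul_swap {f : Perm X} (hf : f.IsThreeCycle) :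
    ∃ x y z, x ≠ y ∧ x ≠ z ∧ y ≠ z ∧ f.support = {x, y, z} ∧ f = swap x y * swap x z := by
  obtain ⟨x, hx⟩ := Finset.card_pos.1 (by rw [hf.card_support]; norm_num : 0 < f.support.card)
  have hnd := hf.nodup_iff_mem_support.2 hx
  have heq := hf.eq_swap_mul_swap_iff_mem_support.2 hx
  simp only [List.nodup_cons, List.mem_cons, List.not_mem_nil, or_false, not_or] at hnd
  obtain ⟨⟨h1, h2⟩, h3, -⟩ := hnd
  refine ⟨f x, x, f (f x), Ne.symm h1, h3, h2, ?_, by rwa [swap_comm (f x) x]⟩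
  symm
  apply Finset.eq_of_subset_of_card_le
  · intro y hy
    simp only [Finset.mem_insert, Finset.mem_singleton] at hy
    rcases hy with rfl | rfl | rfl <;> simpa using hx
  · rw [hf.card_support]
    have := List.toFinset_card_of_nodup (l := [f x, x, f (f x)]) (by simp; grind)
    simpa using this.ge

/-- A modular subgroup with a 3-cycle but without transpositions contains all 3-cycles: the points
of a 3-cycle in it can be exchanged one at a time. -/
theorem IsModularElement.alternatingGroup_le (hH : IsModularElement H) (hs : ¬ HasSwap H)
    {g : Perm X} (hg : g.IsThreeCycle) (hgH : g ∈ H) : alternatingGroup X ≤ H := by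
  -- the 3-cycle `swap x y * swap x z` belongs to `H`
  set T : X → X → X → Prop := fun x y z => x ≠ y ∧ x ≠ z ∧ y ≠ z ∧ swap x y * swap x z ∈ H
  have rot : ∀ {x y z}, T x y z → T y z x := by
    rintro x y z ⟨h1, h2, h3, h4⟩
    refine ⟨h3, h1.symm, h2.symm, ?_⟩
    have : swap y z * swap y x = swap x y * swap x z := by
      ext i
      simp only [Perm.mul_apply, swap_apply_def]
      grind
    rwa [this]
  have flip : ∀ {x y z}, T x y z → T x z y := by
    rintro x y z ⟨h1, h2, h3, h4⟩
    refine ⟨h2, h1, h3.symm, ?_⟩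
    have := inv_mem h4
    simpa using this
  have exch : ∀ {x y z w}, T x y z → w ≠ x → w ≠ y → T x y w := by
    rintro x y z w hxyz hwx hwy
    rcases eq_or_ne w z with rfl | hwz
    · exact hxyz
    obtain ⟨h1, h2, h3, h4⟩ := flip hxyz
    -- this 3-cycle maps `x` to `y` and fixes `w`
    obtain ⟨f, hf⟩ : ∃ f, f = swap x z * swap x y := ⟨_, rfl⟩
    rw [← hf] at h4
    have fx : f x = y := by simp [hf, swap_apply_of_ne_of_ne h2.symm h3.symm]
    have fw : f w = w := by
      simp [hf, swap_apply_of_ne_of_ne hwx hwy, swap_apply_of_ne_of_ne hwx hwz]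
    obtain ⟨k, hk, hks, -, hk'⟩ := hH.exists_small h4 (x := x) (y := w) (s := {x, y, w})
      Finset.card_le_three (by simp) (by simp) (by simp [fx]) (by simp [fw])
      (by
        rw [fx, fw]
        intro hsw
        have := congrArg (fun σ => σ w) hsw
        simp only [swap_apply_right] at this
        exact h2 this.symm) hwx.symm
    rcases hk' with ⟨p, q, hpq, rfl⟩ | hk'
    · exact absurd ⟨p, q, hpq, hk⟩ hs
    · obtain ⟨p, q, r, t1, t2, t3, hsup, hk2⟩ := hk'.exists_eq_swap_mul_swap
      have ht : T p q r := ⟨t1, t2, t3, hk2 ▸ hk⟩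
      have hp : p ∈ ({x, y, w} : Finset X) := hks (by simp [hsup])
      have hq : q ∈ ({x, y, w} : Finset X) := hks (by simp [hsup])
      have hr : r ∈ ({x, y, w} : Finset X) := hks (by simp [hsup])
      simp only [Finset.mem_insert, Finset.mem_singleton] at hp hq hr
      have c1 := rot ht
      have c2 := rot c1
      have d0 := flip ht
      have d1 := flip c1
      have d2 := flip c2
      clear_value T
      rcases hp with rfl | rfl | rfl <;> rcases hq with rfl | rfl | rfl <;>
        rcases hr with rfl | rfl | rfl <;> first | assumption | contradiction
  obtain ⟨a, b, c, h1, h2, h3, -, h4⟩ := hg.exists_eq_swap_mul_swap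
  have habc : T a b c := ⟨h1, h2, h3, h4 ▸ hgH⟩
  have all1 : ∀ x, ∃ y z, T x y z := by
    intro x
    by_cases hxa : x = a
    · exact ⟨b, c, hxa ▸ habc⟩
    by_cases hxb : x = b
    · exact ⟨c, a, hxb ▸ rot habc⟩
    · exact ⟨a, b, rot (rot (exch habc hxa hxb))⟩
  have all2 : ∀ x y, x ≠ y → ∃ z, T x y z := by
    intro x y hxy
    obtain ⟨p, q, h⟩ := all1 x
    by_cases hyp : y = p
    · exact ⟨q, hyp ▸ h⟩
    · exact ⟨p, flip (exch h hxy.symm hyp)⟩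
  rw [← closure_three_cycles_eq_alternating, Subgroup.closure_le]
  intro k hk
  obtain ⟨x, y, z, h1, h2, h3, -, rfl⟩ := IsThreeCycle.exists_eq_swap_mul_swap hk
  obtain ⟨p, h⟩ := all2 x y h1
  exact (exch h h2.symm h3.symm).2.2.2

theorem eq_alternatingGroup_of_not_hasSwap (hs : ¬ HasSwap H) (hA : alternatingGroup X ≤ H) :
    H = alternatingGroup X := by
  refine le_antisymm (fun f hf => ?_) hA
  rw [mem_alternatingGroup]
  by_contra hsign
  have hsign' : sign f = -1 := (Int.units_eq_one_or _).resolve_left hsign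
  have hf1 : f ≠ 1 := by
    rintro rfl
    exact hsign (map_one _)
  obtain ⟨a, ha⟩ := not_forall.1 fun h => hf1 (Perm.ext h)
  rw [Perm.one_apply] at ha
  have : swap a (f a) * f⁻¹ ∈ H := hA (by
    rw [mem_alternatingGroup]
    simp [sign_swap (Ne.symm ha), hsign'])
  exact hs ⟨a, f a, Ne.symm ha, by simpa using mul_mem this hf⟩

/-- A nontrivial modular subgroup without transpositions and 3-cycles consists of the identity and
of fixed-point-free involutions. -/
theorem IsModularElement.apply_apply_and_apply_ne (hH : IsModularElement H) (hs : ¬ HasSwap H)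
    (h3 : ∀ g ∈ H, ¬ g.IsThreeCycle) {g : Perm X} (hg : g ∈ H) (hg1 : g ≠ 1) (x : X) :
    g (g x) = x ∧ g x ≠ x := by
  have small : ∀ {x y : X} {s : Finset X}, s.card ≤ 3 → x ∈ s → y ∈ s → g x ∈ s → g y ∈ s →
      x ≠ y → swap (g x) (g y) = swap x y := by
    intro x y s hcard hx hy hgx hgy hxy
    by_contra hne
    obtain ⟨k, hk, -, -, hk'⟩ := hH.exists_small hg hcard hx hy hgx hgy hne hxy
    rcases hk' with ⟨p, q, hpq, rfl⟩ | hk'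
    · exact hs ⟨p, q, hpq, hk⟩
    · exact h3 k hk hk'
  have inv : ∀ x, g (g x) = x := by
    intro x
    by_cases hx : g x = x
    · rw [hx, hx]
    have h := small (x := x) (y := g x) (s := {x, g x, g (g x)}) Finset.card_le_three
      (by simp) (by simp) (by simp) (by simp) (Ne.symm hx)
    have := congrArg (fun σ => σ (g x)) h
    simpa using this
  refine ⟨inv x, fun hx => hg1 ?_⟩
  ext y
  by_contra hy
  rw [Perm.one_apply] at hy
  have hxy : y ≠ x := by
    rintro rfl
    exact hy hx
  have h := small (x := y) (y := x) (s := {y, x, g y}) Finset.card_le_three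
    (by simp) (by simp) (by simp) (by simp [hx]) hxy
  have := congrArg (fun σ => σ x) h
  simp only [hx, swap_apply_right] at this
  exact hy this

/-- A nontrivial modular subgroup without transpositions and 3-cycles lives on four points and
contains two double transpositions. -/
theorem IsModularElement.exists_double_swaps (hH : IsModularElement H) (hs : ¬ HasSwap H)
    (h3 : ∀ g ∈ H, ¬ g.IsThreeCycle) (hbot : H ≠ ⊥) : Fintype.card X = 4 ∧
      ∃ a b c d, [a, b, c, d].Nodup ∧ (∀ x, x = a ∨ x = b ∨ x = c ∨ x = d) ∧
        swap a b * swap c d ∈ H ∧ swap a c * swap b d ∈ H := by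
  obtain ⟨g, hg, hg1⟩ := H.bot_or_exists_ne_one.resolve_left hbot
  have hfp := fun {f : Perm X} (hf : f ∈ H) (hf1 : f ≠ 1) x =>
    hH.apply_apply_and_apply_ne hs h3 hf hf1 x
  obtain ⟨a, ha⟩ := not_forall.1 fun h => hg1 (Perm.ext h)
  rw [Perm.one_apply] at ha
  have hinj := g.injective
  have gga := (hfp hg hg1 a).1
  obtain ⟨c, hca, hcb⟩ : ∃ c, c ≠ a ∧ c ≠ g a := by
    by_contra! hcon
    refine hs ⟨a, g a, Ne.symm ha, ?_⟩
    have : g = swap a (g a) := by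
      ext x
      simp only [swap_apply_def]
      have := hcon x
      grind
    exact this ▸ hg
  have hc := hfp hg hg1 c
  have hnd : [a, g a, c, g c].Nodup := by
    simp only [List.nodup_cons, List.mem_cons, List.not_mem_nil, or_false, not_or]
    grind
  have hac : swap a c * swap (g a) (g c) ∈ H := by
    have := hH.mul_conj_mem hg (t := swap a c) (swap_mul_self a c) (by
      rw [← swap_apply_apply]
      ext x
      simp only [Perm.mul_apply, swap_apply_def]
      grind)
    rwa [← swap_apply_apply] at this
  have hall : ∀ x, x = a ∨ x = g a ∨ x = c ∨ x = g c := by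
    intro x
    by_contra! hx
    refine (hfp hac ?_ x).2 ?_
    · intro h1
      have := congrArg (fun σ => σ a) h1
      simp only [Perm.mul_apply, swap_apply_def, Perm.one_apply] at this
      grind
    · simp only [Perm.mul_apply, swap_apply_def]
      grind
  refine ⟨?_, a, g a, c, g c, hnd, hall, ?_, hac⟩
  · have huniv : ({a, g a, c, g c} : Finset X) = Finset.univ := by
      ext x
      simpa using hall x
    rw [← Finset.card_univ, ← huniv]
    simpa using List.toFinset_card_of_nodup hnd
  · have : swap a (g a) * swap c (g c) = g := by
      ext x
      simp only [Perm.mul_apply, swap_apply_def]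
      rcases hall x with rfl | rfl | rfl | rfl <;> grind
    rwa [this]

theorem eq_top_of_hasSwap_of_card_le_two (h : HasSwap H) (hX : Fintype.card X ≤ 2) : H = ⊤ := by
  obtain ⟨a, b, hab, hmem⟩ := h
  have hall : ∀ x, x = a ∨ x = b := by
    intro x
    by_contra! hx
    have := List.toFinset_card_of_nodup (l := [a, b, x]) (by simp; grind)
    have := Finset.card_le_univ ([a, b, x].toFinset)
    simp_all
    omega
  refine eq_top_of_swap_mem fun x y hxy => ?_
  rcases hall x with rfl | rfl <;> rcases hall y with rfl | rfl
  · exact absurd rfl hxy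
  · exact hmem
  · exact swap_comm x y ▸ hmem
  · exact absurd rfl hxy

/-- A modular subgroup without transpositions and 3-cycles, which is trivial or the Klein
four-group, lies below every nontrivial modular subgroup. -/
theorem IsModularElement.le_of_not_hasSwap (hH : IsModularElement H) (hs : ¬ HasSwap H)
    (h3 : ∀ g ∈ H, ¬ g.IsThreeCycle) (hK : IsModularElement K) (hbot : K ≠ ⊥) : H ≤ K := by
  intro g hg
  rcases eq_or_ne g 1 with rfl | hg1
  · exact one_mem K
  have hX := (hH.exists_double_swaps hs h3 (by
    rintro rfl
    exact hg1 (Subgroup.mem_bot.1 hg))).1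
  have hfp := hH.apply_apply_and_apply_ne hs h3 hg hg1
  by_cases hKs : HasSwap K
  · obtain ⟨a, b, c, d, hnd, hall, h1, h2, h3⟩ := hK.mem_of_hasSwap_four hKs hX
    exact mem_of_double_swaps hnd hall (mul_mem h1 h2) h3 hfp
  by_cases hK3 : ∀ g ∈ K, ¬ g.IsThreeCycle
  · obtain ⟨-, a, b, c, d, hnd, hall, h1, h2⟩ := hK.exists_double_swaps hKs hK3 hbot
    exact mem_of_double_swaps hnd hall h1 h2 hfp
  · push Not at hK3
    obtain ⟨k, hk, hk3⟩ := hK3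
    have hA := hK.alternatingGroup_le hKs hk3 hk
    obtain ⟨x, y, hxy⟩ := Fintype.exists_pair_of_one_lt_card (by omega : 1 < Fintype.card X)
    obtain ⟨c, d, hnd, hall⟩ := exists_enumeration_of_card_eq_four hX hxy
    have hnd' := hnd
    simp only [List.nodup_cons, List.mem_cons, List.not_mem_nil, or_false, not_or] at hnd'
    obtain ⟨⟨n1, n2, n3⟩, ⟨n4, n5⟩, n6, -⟩ := hnd'
    exact mem_of_double_swaps hnd hall
      (hA (mul_mem_alternatingGroup_of_isSwap ⟨x, y, n1, rfl⟩ ⟨c, d, n6, rfl⟩))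
      (hA (mul_mem_alternatingGroup_of_isSwap ⟨x, c, n2, rfl⟩ ⟨y, d, n5, rfl⟩)) hfp

/-- Two modular subgroups of a finite symmetric group are comparable unless they form one of the
forbidden pairs. -/
theorem IsModularElement.le_or_le_or_isForbiddenPair (hH : IsModularElement H)
    (hK : IsModularElement K) :
    H ≤ K ∨ K ≤ H ∨ IsForbiddenPair H K ∨ IsForbiddenPair K H := by
  by_cases hHb : H = ⊥
  · exact Or.inl (hHb ▸ bot_le)
  by_cases hKb : K = ⊥
  · exact Or.inr (Or.inl (hKb ▸ bot_le))
  by_cases hHt : H = ⊤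
  · exact Or.inr (Or.inl (hHt ▸ le_top))
  by_cases hKt : K = ⊤
  · exact Or.inl (hKt ▸ le_top)
  have card : ∀ {L : Subgroup (Perm X)}, IsModularElement L → L ≠ ⊤ → HasSwap L →
      (Fintype.card X = 3 ∧ IsTranspositionGroup L) ∨
        (Fintype.card X = 4 ∧ IsDihedralGroup L) := by
    intro L hL hLt hLs
    have h2 : ¬ Fintype.card X ≤ 2 := fun h => hLt (eq_top_of_hasSwap_of_card_le_two hLs h)
    have h5 : ¬ 5 ≤ Fintype.card X := fun h => hLt (hL.eq_top_of_hasSwap hLs h)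
    rcases (by omega : Fintype.card X = 3 ∨ Fintype.card X = 4) with h | h
    · exact Or.inl ⟨h, isTranspositionGroup_of_hasSwap hLs h hLt⟩
    · exact Or.inr ⟨h, hL.isDihedralGroup_of_hasSwap hLs h hLt⟩
  have cases : ∀ {L : Subgroup (Perm X)}, IsModularElement L → ¬ HasSwap L →
      (∀ g ∈ L, ¬ g.IsThreeCycle) ∨ L = alternatingGroup X := by
    intro L hL hLs
    by_cases h : ∀ g ∈ L, ¬ g.IsThreeCycle
    · exact Or.inl h
    · push Not at h
      obtain ⟨g, hg, hg3⟩ := h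
      exact Or.inr (eq_alternatingGroup_of_not_hasSwap hLs (hL.alternatingGroup_le hLs hg3 hg))
  by_cases hHs : HasSwap H <;> by_cases hKs : HasSwap K
  · rcases card hH hHt hHs with ⟨h1, h2⟩ | ⟨h1, h2⟩ <;>
      rcases card hK hKt hKs with ⟨h3, h4⟩ | ⟨h3, h4⟩
    · exact Or.inr (Or.inr (Or.inl (Or.inl ⟨h2, h4⟩)))
    · omega
    · omega
    · exact Or.inr (Or.inr (Or.inl (Or.inr (Or.inr (Or.inl ⟨h2, h4⟩)))))
  · rcases cases hK hKs with h | h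
    · exact Or.inr (Or.inl (hK.le_of_not_hasSwap hKs h hH hHb))
    · refine Or.inr (Or.inr (Or.inl ?_))
      rcases card hH hHt hHs with ⟨h1, h2⟩ | ⟨h1, h2⟩
      · exact Or.inr (Or.inl ⟨h2, h1, h⟩)
      · exact Or.inr (Or.inr (Or.inr ⟨h2, h1, h⟩))
  · rcases cases hH hHs with h | h
    · exact Or.inl (hH.le_of_not_hasSwap hHs h hK hKb)
    · refine Or.inr (Or.inr (Or.inr ?_))
      rcases card hK hKt hKs with ⟨h1, h2⟩ | ⟨h1, h2⟩
      · exact Or.inr (Or.inl ⟨h2, h1, h⟩)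
      · exact Or.inr (Or.inr (Or.inr ⟨h2, h1, h⟩))
  · rcases cases hH hHs with h | h
    · exact Or.inl (hH.le_of_not_hasSwap hHs h hK hKb)
    rcases cases hK hKs with h' | h'
    · exact Or.inr (Or.inl (hK.le_of_not_hasSwap hKs h' hH hHb))
    · exact Or.inl (h.trans h'.symm).le

end ModularSubgroups

/-! ### Words and fully invariant congruences -/

/-- Words over the alphabet `ℕ` with substitution of words for letters. Only substitution is
recorded, so that semigroup words and unary words can be treated alike. -/
class WordAlgebra (W : Type) where
  letter : ℕ → W
  subst : (ℕ → W) → W → W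
  content : W → Finset ℕ
  content_nonempty : ∀ w, (content w).Nonempty
  subst_letter : ∀ f i, subst f (letter i) = f i
  subst_letter_self : ∀ w, subst letter w = w
  subst_subst : ∀ f g w, subst g (subst f w) = subst (fun i => subst g (f i)) w
  subst_congr : ∀ f g w, (∀ i ∈ content w, f i = g i) → subst f w = subst g w
  mem_content_subst : ∀ f w x, x ∈ content (subst f w) ↔ ∃ i ∈ content w, x ∈ content (f i)
  mem_content_letter : ∀ i x, x ∈ content (letter i) ↔ x = i

namespace WordAlgebra

variable {W : Type}

/-- The relation reached by alternating steps of two relations. -/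
def Join (R S : W → W → Prop) : W → W → Prop := Relation.ReflTransGen fun a b => R a b ∨ S a b

theorem Join.left {R S : W → W → Prop} {a b : W} (h : R a b) : Join R S a b :=
  Relation.ReflTransGen.single (Or.inl h)

theorem Join.right {R S : W → W → Prop} {a b : W} (h : S a b) : Join R S a b :=
  Relation.ReflTransGen.single (Or.inr h)

theorem Join.map {R S : W → W → Prop} {F : W → W} (hR : ∀ a b, R a b → R (F a) (F b))
    (hS : ∀ a b, S a b → S (F a) (F b)) {a b : W} (h : Join R S a b) : Join R S (F a) (F b) :=
  Relation.ReflTransGen.lift (r := fun a b => R a b ∨ S a b) (p := fun a b => R a b ∨ S a b) F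
    (fun a b => Or.imp (hR a b) (hS a b)) _ _ h

theorem Join.equivalence {R S : W → W → Prop} (hR : ∀ {a b}, R a b → R b a)
    (hS : ∀ {a b}, S a b → S b a) : Equivalence (Join R S) where
  refl _ := Relation.ReflTransGen.refl
  symm h := by
    induction h with
    | refl => exact Relation.ReflTransGen.refl
    | tail _ h ih => exact Relation.ReflTransGen.head (Or.imp hR hS h) ih
  trans := Relation.ReflTransGen.trans

variable [WordAlgebra W]

/-- Renaming of the letters of a word by a permutation of the alphabet. -/
def permute (σ : Equiv.Perm ℕ) (w : W) : W := subst (fun i => letter (σ i)) w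

theorem permute_one (w : W) : permute 1 w = w := subst_letter_self w

theorem permute_mul (σ τ : Equiv.Perm ℕ) (w : W) : permute (σ * τ) w = permute σ (permute τ w) := by
  simp only [permute, subst_subst, subst_letter, Equiv.Perm.mul_apply]

theorem permute_inv_permute (σ : Equiv.Perm ℕ) (w : W) : permute σ⁻¹ (permute σ w) = w := by
  rw [← permute_mul, inv_mul_cancel, permute_one]

theorem permute_permute_inv (σ : Equiv.Perm ℕ) (w : W) : permute σ (permute σ⁻¹ w) = w := by
  rw [← permute_mul, mul_inv_cancel, permute_one]

theorem mem_content_permute {σ : Equiv.Perm ℕ} {w : W} {x : ℕ} :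
    x ∈ content (permute σ w) ↔ σ⁻¹ x ∈ content w := by
  simp only [permute, mem_content_subst, mem_content_letter]
  constructor
  · rintro ⟨i, hi, rfl⟩
    simpa using hi
  · exact fun h => ⟨_, h, by simp⟩

/-- A permutation of a finite set of letters, extended to the alphabet. -/
abbrev extend {X : Finset ℕ} (σ : Equiv.Perm X) : Equiv.Perm ℕ := Equiv.Perm.ofSubtype σ

theorem content_permute_extend {X : Finset ℕ} (σ : Equiv.Perm X) {w : W} (hw : content w = X) :
    content (permute (extend σ) w) = X := by
  subst hw
  ext x
  rw [mem_content_permute, extend, ← map_inv]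
  exact Equiv.Perm.ofSubtype_apply_mem_iff_mem _ x

/-- A permutation of the alphabet that maps the content of `w` to itself acts on `w` as a
permutation of the content. -/
theorem exists_extend_of_content_permute_eq {X : Finset ℕ} {σ : Equiv.Perm ℕ} {w : W}
    (hw : content w = X) (h : content (permute σ w) = X) :
    ∃ ρ : Equiv.Perm X, permute σ w = permute (extend ρ) w := by
  have hσ : ∀ x, σ x ∈ X ↔ x ∈ X := by
    intro x
    rw [← h, mem_content_permute, Equiv.Perm.inv_def, Equiv.symm_apply_apply, hw, h]
  refine ⟨σ.subtypePerm hσ, subst_congr _ _ _ fun i hi => ?_⟩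
  rw [hw] at hi
  rw [extend, Equiv.Perm.ofSubtype_apply_of_mem _ hi]
  rfl

/-- A fully invariant congruence, described by substitutions alone. -/
structure IsFullyInvariant (R : W → W → Prop) : Prop where
  equivalence : Equivalence R
  subst : ∀ f {u v}, R u v → R (subst f u) (subst f v)
  congr : ∀ {f g : ℕ → W} w, (∀ i, R (f i) (g i)) →
    R (WordAlgebra.subst f w) (WordAlgebra.subst g w)

namespace IsFullyInvariant

variable {R : W → W → Prop} (hR : IsFullyInvariant R)
include hR

theorem refl (u : W) : R u u := hR.equivalence.refl u

theorem symm {u v : W} (h : R u v) : R v u := hR.equivalence.symm h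

theorem trans {u v w : W} (h : R u v) (h' : R v w) : R u w := hR.equivalence.trans h h'

theorem permute (σ : Equiv.Perm ℕ) {u v : W} (h : R u v) : R (permute σ u) (permute σ v) :=
  hR.subst _ h

theorem of_permute {σ : Equiv.Perm ℕ} {u v : W} (h : R (WordAlgebra.permute σ u) v) :
    R u (WordAlgebra.permute σ⁻¹ v) := by
  simpa only [permute_inv_permute] using hR.permute σ⁻¹ h

end IsFullyInvariant

/-- The stabilizer of a word in the group of permutations of a finite set `X` of letters, modulo a
relation that is invariant under permutations. -/
def stabilizer {R : W → W → Prop} (hR : Equivalence R)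
    (hp : ∀ (σ : Equiv.Perm ℕ) {u v}, R u v → R (permute σ u) (permute σ v))
    (X : Finset ℕ) (w : W) : Subgroup (Equiv.Perm X) where
  carrier := {σ | R w (permute (extend σ) w)}
  one_mem' := by
    simp only [Set.mem_ofPred_eq, extend, map_one, permute_one]
    exact hR.refl w
  mul_mem' := by
    intro σ τ hσ hτ
    simp only [Set.mem_ofPred_eq, extend, map_mul, permute_mul] at *
    exact hR.trans hσ (hp _ hτ)
  inv_mem' := by
    intro σ hσ
    simp only [Set.mem_ofPred_eq, extend, map_inv] at *
    have := hp (Equiv.Perm.ofSubtype σ)⁻¹ hσ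
    rw [permute_inv_permute] at this
    exact hR.symm this

/-- The stabilizer of a word modulo a fully invariant congruence. -/
abbrev IsFullyInvariant.stab {R : W → W → Prop} (hR : IsFullyInvariant R) (X : Finset ℕ) (w : W) :
    Subgroup (Equiv.Perm X) :=
  stabilizer hR.equivalence hR.permute X w

/-- The set `I` consists of zero words of the fully invariant congruence `ν`: it is an ideal on
which `ν` is constant, and outside `I` all identities in `ν` are substitutive. The ideal property is
expressed by substituting a member of `I` for some letter of a word. -/
structure IsZeroIdeal (ν : W → W → Prop) (I : Set W) : Prop where
  nonempty : I.Nonempty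
  subst : ∀ f {w}, w ∈ I → subst f w ∈ I
  subst_mem : ∀ {f : ℕ → W} {w i}, i ∈ content w → f i ∈ I → WordAlgebra.subst f w ∈ I
  rel : ∀ {p q}, p ∈ I → q ∈ I → ν p q
  exists_content_union : ∀ {p q}, p ∈ I → q ∈ I → ∃ r ∈ I, content r = content p ∪ content q
  substitutive : ∀ {p q}, ν p q → p ∉ I → content p = content q ∧ ∃ σ, q = permute σ p

theorem IsZeroIdeal.permute_mem_iff {ν : W → W → Prop} {I : Set W} (hI : IsZeroIdeal ν I)
    {σ : Equiv.Perm ℕ} {w : W} : permute σ w ∈ I ↔ w ∈ I := by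
  refine ⟨fun h => ?_, fun h => hI.subst _ h⟩
  have := hI.subst (fun i => letter (σ⁻¹ i)) h
  exact permute_inv_permute σ w ▸ this

/-! ### Chains of congruences -/

section Chain

variable {ν γ : W → W → Prop} {I : Set W}

/-- If two words with different contents are congruent, both are congruent to zero words. -/
theorem exists_zero_of_content_ne (hγ : IsFullyInvariant γ) (hI : IsZeroIdeal ν I) {p q : W}
    (h : γ p q) (hne : content p ≠ content q) : ∃ i ∈ I, γ p i := by
  obtain ⟨z, hz⟩ := hI.nonempty
  obtain ⟨x, hx⟩ : ∃ x, ¬(x ∈ content p ↔ x ∈ content q) := by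
    by_contra! hcon
    exact hne (Finset.ext hcon)
  have hs : ∀ w : W, x ∉ content w → subst (Function.update letter x z) w = w := by
    intro w hw
    conv_rhs => rw [← subst_letter_self w]
    refine subst_congr _ _ _ fun i hi => Function.update_of_ne ?_ _ _
    rintro rfl
    exact hw hi
  have h1 := hγ.subst (Function.update letter x z) h
  by_cases hp : x ∈ content p
  · have hq : x ∉ content q := fun hq => hx ⟨fun _ => hq, fun _ => hp⟩
    rw [hs q hq] at h1
    exact ⟨_, hI.subst_mem hp (by simpa using hz), hγ.trans h (hγ.symm h1)⟩
  · have hq : x ∈ content q := by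
      by_contra hq
      exact hx ⟨fun h => absurd h hp, fun h => absurd h hq⟩
    rw [hs p hp] at h1
    exact ⟨_, hI.subst_mem hq (by simpa using hz), h1⟩

/-- Words on a chain of `ν`- and `γ`-steps that starts at `u` arise, as long as no word
`γ`-congruent to `u` is zero, from words `γ`-congruent to `u` by permutations in the join of their
stabilizers. -/
theorem exists_zero_or_exists_permute (hν : IsFullyInvariant ν) (hγ : IsFullyInvariant γ)
    (hI : IsZeroIdeal ν I) {u w : W} (h : Join ν γ u w) :
    (∃ i ∈ I, γ u i) ∨
      ∃ b, γ u b ∧ content b = content u ∧ b ∉ I ∧ ∃ σ : Equiv.Perm (content u),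
        w = permute (extend σ) b ∧
        σ ∈ ⨆ p ∈ {p | γ u p ∧ content p = content u ∧ p ∉ I}, hν.stab (content u) p := by
  induction h with
  | refl =>
    by_cases hu : u ∈ I
    · exact Or.inl ⟨u, hu, hγ.refl u⟩
    · exact Or.inr ⟨u, hγ.refl u, rfl, hu, 1, by simp [extend, permute_one], one_mem _⟩
  | @tail _ c _ h ih =>
    rcases ih with hi | ⟨b, hub, hb, hbI, σ, rfl, hσ⟩
    · exact Or.inl hi
    rcases h with h | h
    -- A `ν`-step multiplies `σ` on the right by an element of the stabilizer of `b`.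
    · have h1 := hν.of_permute h
      obtain ⟨h2, τ, h3⟩ := hI.substitutive h1 hbI
      obtain ⟨ρ, hρ⟩ := exists_extend_of_content_permute_eq hb (σ := τ) (by rw [← h3, ← h2, hb])
      rw [hρ] at h3
      refine Or.inr ⟨b, hub, hb, hbI, σ * ρ, ?_, mul_mem hσ ?_⟩
      · rw [extend, map_mul, permute_mul, ← h3, permute_permute_inv]
      · refine (le_iSup₂_of_le b ⟨hub, hb, hbI⟩ le_rfl :
          hν.stab (content u) b ≤ _) ?_
        change ν b _
        rwa [← h3]
    -- A `γ`-step replaces `b` and leaves `σ` as it is.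
    · have h1 := hγ.trans hub (hγ.of_permute h)
      by_cases hz : permute (extend σ)⁻¹ c ∈ I
      · exact Or.inl ⟨_, hz, h1⟩
      by_cases hc : content (permute (extend σ)⁻¹ c) = content u
      · exact Or.inr ⟨_, h1, hc, hz, σ, (permute_permute_inv _ _).symm, hσ⟩
      · exact Or.inl (exists_zero_of_content_ne hγ hI h1 (Ne.symm hc))

/-- Along a chain of `ν`- and `γ`-steps, being `γ`-congruent to a zero word propagates. -/
theorem exists_zero_of_join (hν : IsFullyInvariant ν) (hγ : IsFullyInvariant γ)
    (hI : IsZeroIdeal ν I) {u w : W} (h : Join ν γ u w) (hw : ∃ i ∈ I, γ w i) :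
    ∃ i ∈ I, γ u i := by
  rcases exists_zero_or_exists_permute hν hγ hI h with hu | ⟨b, hub, -, -, σ, rfl, -⟩
  · exact hu
  · obtain ⟨i, hi, hbi⟩ := hw
    exact ⟨_, hI.permute_mem_iff.2 hi, hγ.trans hub (hγ.of_permute hbi)⟩

end Chain

/-- If the subgroups `A p ⊔ C` form a chain, the modular law holds for the join of the modular
subgroups `A p` in place of a single one: the largest of the `A p ⊔ C` contains all others. -/
theorem inf_iSup_le_of_modular {G ι : Type*} [Group G] [Finite G] {A : ι → Subgroup G}
    {P : Set ι} (hP : P.Nonempty) {B C : Subgroup G} (hCB : C ≤ B)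
    (hA : ∀ p ∈ P, IsModularElement (A p))
    (hdir : ∀ p ∈ P, ∀ q ∈ P, A p ⊔ C ≤ A q ⊔ C ∨ A q ⊔ C ≤ A p ⊔ C) :
    ∃ p ∈ P, B ⊓ ⨆ p ∈ P, A p ≤ (A p ⊓ B) ⊔ C := by
  obtain ⟨L, ⟨⟨p, hp, rfl⟩, hmax⟩⟩ :=
    (Set.toFinite ((fun p => A p ⊔ C) '' P)).exists_maximal (hP.image _)
  refine ⟨p, hp, ?_⟩
  rw [← hA p hp C B hCB, inf_comm]
  refine inf_le_inf_right _ (iSup₂_le fun q hq => le_trans (le_sup_left (b := C)) ?_)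
  rcases hdir p hp q hq with h | h
  · exact hmax ⟨q, hq, rfl⟩ h
  · exact h

/-- Stabilizers of words that differ by a permutation in `C` have the same join with `C`. -/
theorem stab_permute_sup_le {ν : W → W → Prop} (hν : IsFullyInvariant ν) {X : Finset ℕ} {p : W}
    {τ : Equiv.Perm X} {C : Subgroup (Equiv.Perm X)} (hτ : τ ∈ C) :
    hν.stab X (permute (extend τ) p) ⊔ C ≤ hν.stab X p ⊔ C := by
  refine sup_le (fun ρ hρ => ?_) le_sup_right
  have h1 : τ⁻¹ * ρ * τ ∈ hν.stab X p := by
    have := hν.of_permute (hρ : ν _ _)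
    change ν _ _
    simpa only [extend, map_mul, map_inv, permute_mul] using this
  have h2 : τ ∈ hν.stab X p ⊔ C := Subgroup.mem_sup_right hτ
  have := mul_mem (mul_mem h2 (Subgroup.mem_sup_left h1)) (inv_mem h2)
  simpa [mul_assoc] using this

/-- A chain of `ν ⊓ κ`- and `γ`-steps that avoids zero words. Here `κ` contains all pairs of words
with the same content, so that the stabilizers modulo `ν` and `ν ⊓ κ` agree. -/
theorem join_of_permute {ν κ β γ : W → W → Prop} {I : Set W} (hν : IsFullyInvariant ν)
    (hκ : IsFullyInvariant κ) (hβ : IsFullyInvariant β) (hγ : IsFullyInvariant γ)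
    (hκc : ∀ u v, content u = content v → κ u v)
    (hγβ : ∀ u v, γ u v → β u v)
    (hmod : ∀ p ∉ I, IsModularElement (hν.stab (content p) p))
    (hcomp : ∀ p ∉ I, ∀ q ∉ I, content p = content q →
      hν.stab (content p) p ≤ hν.stab (content p) q ∨
      hν.stab (content p) q ≤ hν.stab (content p) p ∨ ∃ τ, q = permute τ p)
    {u b : W} (hub : γ u b) (hbc : content b = content u) (hb : b ∉ I)
    {σ : Equiv.Perm (content u)} (hβu : β u (permute (extend σ) b))
    (hσ : σ ∈ ⨆ p ∈ {p | γ u p ∧ content p = content u ∧ p ∉ I}, hν.stab (content u) p) :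
    Join (fun a b => (ν a b ∧ κ a b) ∧ β a b) γ u (permute (extend σ) b) := by
  set δ : W → W → Prop := Join (fun a b => (ν a b ∧ κ a b) ∧ β a b) γ
  have hδe : Equivalence δ := Join.equivalence
    (fun h => ⟨⟨hν.symm h.1.1, hκ.symm h.1.2⟩, hβ.symm h.2⟩) hγ.symm
  have hδp : ∀ (σ : Equiv.Perm ℕ) {u v}, δ u v → δ (permute σ u) (permute σ v) :=
    fun σ _ _ => Join.map
      (fun _ _ h => ⟨⟨hν.permute σ h.1.1, hκ.permute σ h.1.2⟩, hβ.permute σ h.2⟩)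
      fun _ _ h => hγ.permute σ h
  obtain ⟨p, ⟨hup, hpc, hpI⟩, hle⟩ := inf_iSup_le_of_modular
    (A := fun p => hν.stab (content u) p) (P := {p | γ u p ∧ content p = content u ∧ p ∉ I})
    ⟨b, hub, hbc, hb⟩ (B := hβ.stab (content u) u) (C := hγ.stab (content u) u)
    (fun σ hσ => hγβ _ _ hσ)
    (fun p hp => by
      have := hmod p hp.2.2
      rwa [hp.2.1] at this)
    (by
      rintro p ⟨hup, hpc, hp⟩ q ⟨huq, hqc, hq⟩
      have := hcomp p hp q hq (hpc.trans hqc.symm)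
      rw [hpc] at this
      rcases this with h | h | ⟨τ, hτ⟩
      · exact Or.inl (sup_le_sup_right h _)
      · exact Or.inr (sup_le_sup_right h _)
      · obtain ⟨ρ, hρ⟩ := exists_extend_of_content_permute_eq hpc (σ := τ) (by rw [← hτ, hqc])
        rw [hρ] at hτ
        subst hτ
        refine Or.inr (stab_permute_sup_le hν ?_)
        exact hγ.trans huq (hγ.symm (hγ.permute _ hup)))
  have hmem := hle ⟨show β u _ from hβ.trans hβu (hβ.permute _ (hγβ _ _ (hγ.symm hub))), hσ⟩
  have hsub : (hν.stab (content u) p ⊓ hβ.stab (content u) u) ⊔ hγ.stab (content u) u ≤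
      stabilizer hδe hδp (content u) u := by
    refine sup_le ?_ fun ρ hρ => Join.right hρ
    rintro ρ ⟨hρ1, hρ2⟩
    have h1 : δ u p := Join.right hup
    refine hδe.trans h1 (hδe.trans (Join.left ⟨⟨hρ1, hκc _ _ ?_⟩, ?_⟩)
      (hδp (extend ρ) (hδe.symm h1)))
    · rw [hpc, content_permute_extend ρ hpc]
    · exact hβ.trans (hβ.symm (hγβ _ _ hup)) (hβ.trans hρ2 (hβ.permute _ (hγβ _ _ hup)))
  exact hδe.trans (hsub hmem) (hδp _ (Join.right hub))

/-- A fully invariant congruence `γ` that does not preserve contents allows one to enlarge the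
content of a zero word, provided that `β` identifies it with a zero word of different content. -/
theorem exists_join_content_union {ν κ β γ : W → W → Prop} {I : Set W}
    (hκc : ∀ u v, content u = content v → κ u v) (hβ : IsFullyInvariant β)
    (hγ : IsFullyInvariant γ) (hI : IsZeroIdeal ν I) (hγβ : ∀ u v, γ u v → β u v)
    {s t : W} (hst : γ s t) {x : ℕ} (hxs : x ∈ content s) (hxt : x ∉ content t)
    {p q : W} (hp : p ∈ I) (hq : q ∈ I) (hpq : β p q) (hne : content p ≠ content q) :
    ∃ j ∈ I, content j = content p ∪ content q ∧ β p j ∧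
      Join (fun a b => (ν a b ∧ κ a b) ∧ β a b) γ p j := by
  obtain ⟨r, -, hrc⟩ := hI.exists_content_union hp hq
  -- The word `t` with all letters renamed to `y` is `γ`-congruent to a word of large content.
  let T : ℕ → W := fun y => subst (fun _ => letter y) t
  let S : ℕ → W := fun y => subst (Function.update (fun _ => letter y) x r) s
  have hST : ∀ y, γ (T y) (S y) := by
    intro y
    refine hγ.symm ?_
    have := hγ.subst (Function.update (fun _ => letter y) x r) hst
    rwa [subst_congr _ (fun _ => letter y) t] at this
    intro i hi
    refine Function.update_of_ne ?_ _ _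
    rintro rfl
    exact hxt hi
  have hT : ∀ y z, z ∈ content (T y) ↔ z = y := by
    intro y z
    simp only [T, mem_content_subst, mem_content_letter]
    exact ⟨fun ⟨_, _, h⟩ => h, fun h => (content_nonempty t).imp fun i hi => ⟨hi, h⟩⟩
  have hS : ∀ y ∈ content p, ∀ z, z ∈ content (S y) ↔ z ∈ content p ∪ content q := by
    intro y hy z
    simp only [S, mem_content_subst]
    constructor
    · rintro ⟨i, hi, hz⟩
      rcases eq_or_ne i x with rfl | hix
      · simpa [hrc] using hz
      · rw [Function.update_of_ne hix, mem_content_letter] at hz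
        exact Finset.mem_union_left _ (hz ▸ hy)
    · intro hz
      exact ⟨x, hxs, by simpa [hrc] using hz⟩
  -- It suffices to find a zero word `w` and a set `D` of letters of `w` to be replaced.
  suffices h : ∃ w ∈ I, ∃ D : Finset ℕ, ∃ y ∈ content p, (∃ z ∈ content w, z ∈ D) ∧
      β p (subst (fun i => if i ∈ D then T y else letter i) w) ∧
      content (subst (fun i => if i ∈ D then T y else letter i) w) = content p by
    obtain ⟨w, hw, D, y, hy, ⟨z, hzw, hzD⟩, hβw, hcw⟩ := h
    have h1 : γ (subst (fun i => if i ∈ D then T y else letter i) w)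
        (subst (fun i => if i ∈ D then S y else letter i) w) := by
      refine hγ.congr w fun i => ?_
      split_ifs
      · exact hST y
      · exact hγ.refl _
    refine ⟨_, hI.subst _ hw, ?_, hβ.trans hβw (hγβ _ _ h1), ?_⟩
    · ext k
      rw [mem_content_subst]
      constructor
      · rintro ⟨i, hi, hk⟩
        split_ifs at hk with hiD
        · exact (hS y hy k).1 hk
        · refine Finset.mem_union_left _ (hcw ▸ (mem_content_subst _ _ _).2 ⟨i, hi, ?_⟩)
          rwa [if_neg hiD]
      · intro hk
        exact ⟨z, hzw, by rw [if_pos hzD]; exact (hS y hy k).2 hk⟩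
    · exact Relation.ReflTransGen.trans
        (Join.left ⟨⟨hI.rel hp (hI.subst _ hw), hκc _ _ hcw.symm⟩, hβw⟩) (Join.right h1)
  have fixed : ∀ (D : Finset ℕ) y (w : W), (∀ i ∈ content w, i ∉ D) →
      subst (fun i => if i ∈ D then T y else letter i) w = w := by
    intro D y w h
    conv_rhs => rw [← subst_letter_self w]
    exact subst_congr _ _ _ fun i hi => if_neg (h i hi)
  -- If all letters of `p` occur in `q`, the other letters of `q` are replaced, otherwise a letter
  -- of `p` that does not occur in `q` is.
  by_cases hsub : content p ⊆ content q
  · obtain ⟨y, hy⟩ := content_nonempty p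
    obtain ⟨z, hz, hzp⟩ := Finset.exists_of_ssubset (hsub.ssubset_of_ne hne)
    refine ⟨q, hq, content q \ content p, y, hy, ⟨z, hz, by simp [hz, hzp]⟩, ?_, ?_⟩
    · have := hβ.subst (fun i => if i ∈ content q \ content p then T y else letter i) hpq
      rwa [fixed _ _ p (by simp +contextual)] at this
    · ext k
      rw [mem_content_subst]
      constructor
      · rintro ⟨i, hi, hk⟩
        split_ifs at hk with hiD
        · rw [hT] at hk
          exact hk ▸ hy
        · rw [mem_content_letter] at hk
          subst hk
          simpa [hi] using hiD
      · intro hk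
        exact ⟨k, hsub hk, by rw [if_neg (by simp [hk])]; exact (mem_content_letter _ _).2 rfl⟩
  · obtain ⟨y, hy, hyq⟩ := Finset.not_subset.1 hsub
    refine ⟨p, hp, {y}, y, hy, ⟨y, hy, by simp⟩, ?_, ?_⟩
    · have := hβ.subst (fun i => if i ∈ ({y} : Finset ℕ) then T y else letter i) hpq
      rw [fixed _ _ q (by
        intro i hi h
        exact hyq (Finset.mem_singleton.1 h ▸ hi))] at this
      exact hβ.trans hpq (hβ.symm this)
    · ext k
      rw [mem_content_subst]
      have : ∀ i, k ∈ content (if i ∈ ({y} : Finset ℕ) then T y else letter i) ↔ k = i := by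
        intro i
        split_ifs with h
        · rw [hT, Finset.mem_singleton.1 h]
        · exact mem_content_letter _ _
      simp only [this, exists_eq_right']

/-- The modular law for the fully invariant congruences `ν ⊓ κ`, `γ ≤ β`, where `ν` is the
congruence of a nil-variety and `κ` that of the trivial variety or of the variety of
semilattices. -/
theorem join_inf_of_join {ν κ β γ : W → W → Prop} {I : Set W} (hν : IsFullyInvariant ν)
    (hκ : IsFullyInvariant κ) (hβ : IsFullyInvariant β) (hγ : IsFullyInvariant γ)
    (hI : IsZeroIdeal ν I)
    (hκc : (∀ u v, κ u v) ∨ ∀ u v, κ u v ↔ content u = content v)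
    (hγβ : ∀ u v, γ u v → β u v)
    (hmod : ∀ p ∉ I, IsModularElement (hν.stab (content p) p))
    (hcomp : ∀ p ∉ I, ∀ q ∉ I, content p = content q →
      hν.stab (content p) p ≤ hν.stab (content p) q ∨
      hν.stab (content p) q ≤ hν.stab (content p) p ∨ ∃ τ, q = permute τ p)
    {u v : W} (huv : Join (fun a b => ν a b ∧ κ a b) γ u v) (hβuv : β u v) :
    Join (fun a b => (ν a b ∧ κ a b) ∧ β a b) γ u v := by
  have hκc' : ∀ u v, content u = content v → κ u v := fun u v h =>
    hκc.elim (fun h' => h' u v) fun h' => (h' u v).2 h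
  have hνγ : Join ν γ u v :=
    Relation.ReflTransGen.mono (r := fun a b => (ν a b ∧ κ a b) ∨ γ a b)
      (p := fun a b => ν a b ∨ γ a b) (fun _ _ => Or.imp_left And.left) _ _ huv
  have hνγe : Equivalence (Join ν γ) := Join.equivalence hν.symm hγ.symm
  rcases exists_zero_or_exists_permute hν hγ hI hνγ with hu | ⟨b, hub, hbc, hb, σ, rfl, hσ⟩
  swap
  · exact join_of_permute hν hκ hβ hγ hκc' hγβ hmod hcomp hub hbc hb hβuv hσ
  obtain ⟨i, hi, hui⟩ := hu
  obtain ⟨j, hj, hvj⟩ := exists_zero_of_join hν hγ hI (hνγe.symm hνγ) ⟨i, hi, hui⟩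
  have hβij : β i j := hβ.trans (hβ.symm (hγβ _ _ hui)) (hβ.trans hβuv (hγβ _ _ hvj))
  have hδe : Equivalence (Join (fun a b => (ν a b ∧ κ a b) ∧ β a b) γ) := Join.equivalence
    (fun h => ⟨⟨hν.symm h.1.1, hκ.symm h.1.2⟩, hβ.symm h.2⟩) hγ.symm
  suffices h : Join (fun a b => (ν a b ∧ κ a b) ∧ β a b) γ i j from
    hδe.trans (Join.right hui) (hδe.trans h (Join.right (hγ.symm hvj)))
  by_cases hκij : κ i j
  · exact Join.left ⟨⟨hI.rel hi hj, hκij⟩, hβij⟩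
  have hκc'' := hκc.resolve_left fun h => hκij (h i j)
  have hij : content i ≠ content j := fun h => hκij (hκc' _ _ h)
  obtain ⟨s, t, x, hst, hxs, hxt⟩ :
      ∃ s t x, γ s t ∧ x ∈ content s ∧ x ∉ content t := by
    by_contra! hcon
    have hpres : ∀ s t, γ s t → content s = content t := fun s t h =>
      Finset.Subset.antisymm (fun x => hcon s t x h) fun x => hcon t s x (hγ.symm h)
    refine hij ((hpres _ _ hui).symm.trans (Eq.trans ?_ (hpres _ _ hvj)))
    clear hνγ hβuv hui hvj hβij
    induction huv with
    | refl => rfl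
    | tail _ h ih => exact ih.trans (h.elim (fun h => (hκc'' _ _).1 h.2) (hpres _ _))
  obtain ⟨i', hi', hic, hβi, hδi⟩ :=
    exists_join_content_union hκc' hβ hγ hI hγβ hst hxs hxt hi hj hβij hij
  obtain ⟨j', hj', hjc, hβj, hδj⟩ :=
    exists_join_content_union hκc' hβ hγ hI hγβ hst hxs hxt hj hi (hβ.symm hβij) hij.symm
  refine hδe.trans hδi (hδe.trans (Join.left ⟨⟨hI.rel hi' hj', hκc' _ _ ?_⟩, ?_⟩) (hδe.symm hδj))
  · rw [hic, hjc, Finset.union_comm]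
  · exact hβ.trans (hβ.symm hβi) (hβ.trans hβij hβj)

end WordAlgebra

/-! ### Lattices of equational classes -/

/-- The identities that belong to the intent of a variety, as a relation between words. -/
def Concept.identities {α W : Type*} {r : α → W × W → Prop} (V : Concept α (W × W) r) (p q : W) :
    Prop :=
  (p, q) ∈ V.intent

theorem Concept.identities_iff {α W : Type*} {r : α → W × W → Prop} {V : Concept α (W × W) r}
    {p q : W} : V.identities p q ↔ ∀ S ∈ V.extent, r S (p, q) := by
  rw [Concept.identities, ← V.upperPolar_extent]
  rfl

theorem Concept.mem_extent_iff {α W : Type*} {r : α → W × W → Prop} {V : Concept α (W × W) r}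
    {S : α} : S ∈ V.extent ↔ ∀ p q, V.identities p q → r S (p, q) := by
  rw [← V.lowerPolar_intent]
  exact ⟨fun h p q hpq => h hpq, fun h i hi => h i.1 i.2 hi⟩

theorem Concept.identities_sup {α W : Type*} {r : α → W × W → Prop} {V V' : Concept α (W × W) r}
    {p q : W} : (V ⊔ V').identities p q ↔ V.identities p q ∧ V'.identities p q := by
  simp only [Concept.identities, Concept.intent_sup]
  rfl

theorem Concept.identities_of_le {α W : Type*} {r : α → W × W → Prop} {V V' : Concept α (W × W) r}
    (h : V ≤ V') {p q : W} (hpq : V'.identities p q) : V.identities p q :=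
  Concept.identities_iff.2 fun _ hS => Concept.identities_iff.1 hpq _ (h hS)

/-- Translation of the modular law into fully invariant congruences. By the hypothesis `hreal`, some
algebra satisfies exactly the identities in the join of the congruences of `x` and `z`. -/
theorem Concept.sup_inf_eq_of_join {α W : Type*} {r : α → W × W → Prop}
    {x y z : Concept α (W × W) r} (hyz : y ≤ z)
    (hequiv : Equivalence ((x ⊔ y) ⊓ z).identities)
    (hreal : ∃ S, ∀ p q, r S (p, q) ↔ Relation.ReflTransGen
      (fun a b => x.identities a b ∨ z.identities a b) p q)
    (hmain : ∀ p q, Relation.ReflTransGen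
      (fun a b => x.identities a b ∨ z.identities a b) p q → y.identities p q →
      Relation.ReflTransGen
        (fun a b => (x.identities a b ∧ y.identities a b) ∨ z.identities a b) p q) :
    (x ⊔ y) ⊓ z = (x ⊓ z) ⊔ y := by
  refine le_antisymm ?_ (le_inf (sup_le_sup_right inf_le_left _) (sup_le inf_le_right hyz))
  intro T hT
  rw [Concept.mem_extent_iff]
  intro p q hpq
  rw [Concept.identities_sup] at hpq
  obtain ⟨S, hS⟩ := hreal
  have hSx : S ∈ (x ⊓ z).extent := by
    rw [Concept.extent_inf]
    exact ⟨Concept.mem_extent_iff.2 fun a b h => (hS a b).2 (.single (Or.inl h)),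
      Concept.mem_extent_iff.2 fun a b h => (hS a b).2 (.single (Or.inr h))⟩
  have h1 := hmain p q ((hS p q).1 (Concept.identities_iff.1 hpq.1 S hSx)) hpq.2
  have hstep : ∀ a b, (x.identities a b ∧ y.identities a b) ∨ z.identities a b →
      ((x ⊔ y) ⊓ z).identities a b := by
    rintro a b (h | h)
    · exact Concept.identities_of_le inf_le_left (Concept.identities_sup.2 h)
    · exact Concept.identities_of_le inf_le_right h
  have h2 : ∀ w, Relation.ReflTransGen (fun a b => (x.identities a b ∧ y.identities a b) ∨
      z.identities a b) p w → ((x ⊔ y) ⊓ z).identities p w := by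
    intro w h
    induction h with
    | refl => exact hequiv.refl _
    | tail _ h ih => exact hequiv.trans ih (hstep _ _ h)
  exact Concept.identities_iff.1 (h2 q h1) T hT

/-- A zero element of a semigroup. -/
def IsZeroElement {S : Type v} [Mul S] (z : S) : Prop := ∀ a, z * a = z ∧ a * z = z

theorem IsZeroElement.eq {S : Type v} [Mul S] {y z : S} (hy : IsZeroElement y)
    (hz : IsZeroElement z) : y = z :=
  (hy z).1.symm.trans (hz y).2

theorem IsZeroElement.mul_right {S : Type v} [Mul S] {z : S} (hz : IsZeroElement z) (a : S) :
    IsZeroElement (z * a) := (hz a).1.symm ▸ hz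

theorem IsZeroElement.mul_left {S : Type v} [Mul S] {z : S} (hz : IsZeroElement z) (a : S) :
    IsZeroElement (a * z) := (hz a).2.symm ▸ hz

/-! ### Semigroup words and semigroup varieties -/

namespace SWord

theorem content_of (i : ℕ) : content (FreeSemigroup.of i) = {i} := rfl

theorem content_mul (a b : SWord) : content (a * b) = content a ∪ content b := by
  ext x
  simp [content, or_left_comm]

theorem eval_of {S : Type v} [Semigroup S] (φ : ℕ → S) (i : ℕ) :
    eval φ (FreeSemigroup.of i) = φ i := rfl

theorem eval_mul {S : Type v} [Semigroup S] (φ : ℕ → S) (a b : SWord) :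
    eval φ (a * b) = eval φ a * eval φ b := map_mul _ a b

theorem induction {P : SWord → Prop} (of : ∀ i, P (FreeSemigroup.of i))
    (of_mul : ∀ i w, P w → P (FreeSemigroup.of i * w)) (w : SWord) : P w :=
  FreeSemigroup.recOnMul w of fun i w _ hw => of_mul i w hw

theorem eval_eval {S : Type v} [Semigroup S] (φ : ℕ → S) (f : ℕ → SWord) (w : SWord) :
    eval φ (eval f w) = eval (fun i => eval φ (f i)) w := by
  induction w using induction with
  | of i => rfl
  | of_mul i w ih => simp only [eval_mul, eval_of, ih]

theorem eval_congr {S : Type v} [Semigroup S] {φ ψ : ℕ → S} {w : SWord}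
    (h : ∀ i ∈ content w, φ i = ψ i) : eval φ w = eval ψ w := by
  induction w using induction with
  | of i => exact h i (by simp [content_of])
  | of_mul i w ih =>
    simp only [content_mul, content_of, Finset.mem_union, Finset.mem_singleton] at h
    rw [eval_mul, eval_mul, eval_of, eval_of, h i (Or.inl rfl), ih fun j hj => h j (Or.inr hj)]

theorem eval_letter (w : SWord) : eval FreeSemigroup.of w = w := by
  induction w using induction with
  | of i => rfl
  | of_mul i w ih => rw [eval_mul, ih, eval_of]

theorem rename_eq_eval (f : ℕ → ℕ) (w : SWord) :
    rename f w = eval (fun i => FreeSemigroup.of (f i)) w := by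
  rw [← eval_letter (rename f w), eval_rename]
  rfl

instance : WordAlgebra SWord where
  letter := FreeSemigroup.of
  subst f w := eval f w
  content := content
  content_nonempty w := ⟨w.head, Finset.mem_insert_self _ _⟩
  subst_letter := eval_of
  subst_letter_self := eval_letter
  subst_subst f g w := eval_eval g f w
  subst_congr _ _ _ := eval_congr
  mem_content_subst f w x := by
    induction w using induction with
    | of i => simp [eval_of, content_of]
    | of_mul i w ih => simp [eval_mul, eval_of, content_mul, content_of, ih]
  mem_content_letter i x := by simp [content_of]

theorem permute_eq_rename (σ : Equiv.Perm ℕ) (w : SWord) :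
    WordAlgebra.permute σ w = w.rename σ := (rename_eq_eval σ w).symm

theorem content_rename (f : ℕ → ℕ) (w : SWord) :
    content (rename f w) = (content w).image f := by
  rw [rename_eq_eval]
  induction w using induction with
  | of i => rfl
  | of_mul i w ih =>
    simp only [eval_mul, content_mul, ih, eval_of, content_of, Finset.image_union,
      Finset.image_singleton]

/-- Substitution does not shorten words, as the empty word is not available. -/
theorem length_le_length_eval (f : ℕ → SWord) (w : SWord) :
    w.length ≤ (eval f w).length := by
  have one_le : ∀ w : SWord, 1 ≤ w.length := fun w => Nat.le_add_left 1 _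
  induction w using induction with
  | of i => exact one_le _
  | of_mul i w ih =>
    rw [eval_mul, FreeSemigroup.length_mul, FreeSemigroup.length_mul, eval_of]
    exact add_le_add (one_le _) ih

theorem exists_rename_of_length_eq (f : ℕ → SWord) (w : SWord)
    (h : (eval f w).length = w.length) : ∃ g : ℕ → ℕ, eval f w = rename g w := by
  refine ⟨fun i => (f i).head, ?_⟩
  rw [rename_eq_eval]
  have one_le : ∀ w : SWord, 1 ≤ w.length := fun w => Nat.le_add_left 1 _
  have of_head : ∀ w : SWord, w.length = 1 → w = FreeSemigroup.of w.head := by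
    intro w hw
    have : w.tail = [] := List.eq_nil_of_length_eq_zero (Nat.succ.inj hw)
    exact FreeSemigroup.ext rfl this
  induction w using induction with
  | of i => exact of_head _ h
  | of_mul i w ih =>
    rw [eval_mul, FreeSemigroup.length_mul, FreeSemigroup.length_mul, eval_of] at h
    have h1 := one_le (f i)
    have h2 := length_le_length_eval f w
    have h3 : (FreeSemigroup.of i : SWord).length = 1 := rfl
    rw [eval_mul, eval_mul, eval_of, eval_of, ih (by omega), of_head (f i) (by omega)]
    rfl

/-- If `u ≤ v` and `v` is not longer than `u`, then `v` is obtained from `u` by renaming letters. -/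
theorem LE.exists_rename {u v : SWord} (h : LE u v) (hlen : v.length ≤ u.length) :
    ∃ g : ℕ → ℕ, v = rename g u := by
  obtain ⟨ξ, a, b, hab⟩ := h
  have hξ : ∀ w, ξ w = eval (fun i => ξ (FreeSemigroup.of i)) w := by
    intro w
    induction w using induction with
    | of i => rfl
    | of_mul i w ih => rw [map_mul, eval_mul, ih, eval_of]
  have hlu := length_le_length_eval (fun i => ξ (FreeSemigroup.of i)) u
  rw [← hξ] at hlu
  have one_le : ∀ w : SWord, 1 ≤ w.length := fun w => Nat.le_add_left 1 _
  have hv : v = ξ u := by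
    induction a using WithOne.recOneCoe with
    | one =>
      induction b using WithOne.recOneCoe with
      | one => simpa using hab
      | coe b =>
        rw [one_mul, ← WithOne.coe_mul, WithOne.coe_inj] at hab
        have := one_le b
        have := congrArg FreeSemigroup.length hab
        rw [FreeSemigroup.length_mul] at this
        omega
    | coe a =>
      have ha := one_le a
      induction b using WithOne.recOneCoe with
      | one =>
        rw [mul_one, ← WithOne.coe_mul, WithOne.coe_inj] at hab
        have := congrArg FreeSemigroup.length hab
        rw [FreeSemigroup.length_mul] at this
        omega
      | coe b =>
        rw [← WithOne.coe_mul, ← WithOne.coe_mul, WithOne.coe_inj] at hab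
        have := congrArg FreeSemigroup.length hab
        rw [FreeSemigroup.length_mul, FreeSemigroup.length_mul] at this
        omega
  subst hv
  rw [hξ]
  exact exists_rename_of_length_eq _ _ (by rw [← hξ]; omega)

theorem LE.length_le {u v : SWord} (h : LE u v) : u.length ≤ v.length := by
  by_contra! hlt
  obtain ⟨g, rfl⟩ := h.exists_rename hlt.le
  exact hlt.ne (FreeSemigroup.length_map g u)

/-- Equivalent words with the same letters differ by a permutation of the letters. -/
theorem Equivalent.exists_perm {u v : SWord} (h : Equivalent u v) (hc : u.content = v.content) :
    ∃ τ : Equiv.Perm ℕ, v = u.rename τ := by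
  obtain ⟨g, hg⟩ := h.1.exists_rename h.2.length_le
  have himg : u.content.image g = u.content := by
    rw [← content_rename, ← hg, hc]
  have hinj : Set.InjOn g u.content := Finset.card_image_iff.1 (by rw [himg])
  let e : u.content ≃ u.content := Equiv.ofBijective
    (fun x => ⟨g x, himg.le (Finset.mem_image_of_mem g x.2)⟩)
    ((Finite.injective_iff_bijective).1 fun x y hxy =>
      Subtype.ext (hinj x.2 y.2 (Subtype.ext_iff.1 hxy)))
  refine ⟨Equiv.Perm.ofSubtype e, ?_⟩
  rw [hg, rename_eq_eval, rename_eq_eval]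
  refine eval_congr fun i hi => ?_
  rw [Equiv.Perm.ofSubtype_apply_of_mem _ hi]
  rfl

/-- A fully invariant congruence of the free semigroup. -/
structure IsCongruence (R : SWord → SWord → Prop) : Prop where
  equivalence : Equivalence R
  subst : ∀ f {a b}, R a b → R (eval f a) (eval f b)
  mul_left : ∀ c {a b}, R a b → R (c * a) (c * b)
  mul_right : ∀ c {a b}, R a b → R (a * c) (b * c)

theorem IsCongruence.mul {R : SWord → SWord → Prop} (hR : IsCongruence R) {a b c d : SWord}
    (h : R a b) (h' : R c d) : R (a * c) (b * d) :=
  hR.equivalence.trans (hR.mul_right c h) (hR.mul_left b h')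

theorem IsCongruence.isFullyInvariant {R : SWord → SWord → Prop} (hR : IsCongruence R) :
    WordAlgebra.IsFullyInvariant R where
  equivalence := hR.equivalence
  subst := hR.subst
  congr {f g} w h := by
    change R (eval f w) (eval g w)
    induction w using induction with
    | of i => exact h i
    | of_mul i w ih =>
      rw [eval_mul, eval_mul]
      exact hR.mul (h i) ih

theorem IsCongruence.join {R T : SWord → SWord → Prop} (hR : IsCongruence R)
    (hT : IsCongruence T) : IsCongruence (WordAlgebra.Join R T) where
  equivalence := WordAlgebra.Join.equivalence hR.equivalence.symm hT.equivalence.symm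
  subst f _ _ := WordAlgebra.Join.map (fun _ _ => hR.subst f) fun _ _ => hT.subst f
  mul_left c _ _ := WordAlgebra.Join.map (R := R) (S := T) (F := (c * ·))
    (fun _ _ => hR.mul_left c) fun _ _ => hT.mul_left c
  mul_right c _ _ := WordAlgebra.Join.map (R := R) (S := T) (F := (· * c))
    (fun _ _ => hR.mul_right c) fun _ _ => hT.mul_right c

/-- The quotient of the free semigroup by a fully invariant congruence satisfies exactly the
identities in the congruence. -/
theorem IsCongruence.exists_model {R : SWord → SWord → Prop} (hR : IsCongruence R) :
    ∃ S : SemigroupModel.{u}, ∃ π : SWord → S.carrier, Function.Surjective π ∧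
      (∀ a b, π (a * b) = π a * π b) ∧ (∀ a b, π a = π b ↔ R a b) ∧
      ∀ a b, S.Satisfies (a, b) ↔ R a b := by
  let c : Con SWord := ⟨⟨R, hR.equivalence⟩, hR.mul⟩
  let S : SemigroupModel.{u} := @SemigroupModel.mk (ULift.{u} c.Quotient) inferInstance
    ⟨⟨((FreeSemigroup.of 0 : SWord) : c.Quotient)⟩⟩
  let π : SWord → S.carrier := fun w => ULift.up (w : c.Quotient)
  have hπ : Function.Surjective π := fun ⟨x⟩ => by
    induction x using Con.induction_on with
    | H w => exact ⟨w, rfl⟩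
  have hmul : ∀ a b, π (a * b) = π a * π b := fun _ _ => rfl
  have hiff : ∀ a b, π a = π b ↔ R a b := fun a b => by
    rw [ULift.up_inj]
    exact c.eq
  have heval : ∀ (f : ℕ → SWord) w, eval (fun i => π (f i)) w = π (eval f w) := by
    intro f w
    induction w using induction with
    | of i => rfl
    | of_mul i w ih => rw [eval_mul, ih, eval_mul, hmul]; rfl
  refine ⟨S, π, hπ, hmul, hiff, fun a b => ⟨fun h => ?_, fun h φ => ?_⟩⟩
  · have := h fun i => π (FreeSemigroup.of i)
    rwa [heval, heval, hiff, eval_letter, eval_letter] at this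
  · choose f hf using fun i => hπ (φ i)
    obtain rfl : (fun i => π (f i)) = φ := funext hf
    rw [heval, heval, hiff]
    exact hR.subst f h

end SWord

namespace SemigroupVariety

variable {V N : SemigroupVariety.{u}}

theorem isCongruence_identities (V : SemigroupVariety.{u}) : SWord.IsCongruence V.identities where
  equivalence :=
    { refl := fun _ => Concept.identities_iff.2 fun _ _ _ => rfl
      symm := fun h => Concept.identities_iff.2 fun S hS φ =>
        (Concept.identities_iff.1 h S hS φ).symm
      trans := fun h h' => Concept.identities_iff.2 fun S hS φ =>
        (Concept.identities_iff.1 h S hS φ).trans (Concept.identities_iff.1 h' S hS φ) }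
  subst f _ _ h := Concept.identities_iff.2 fun S hS φ => by
    simp only [SWord.eval_eval]
    exact Concept.identities_iff.1 h S hS _
  mul_left c _ _ h := Concept.identities_iff.2 fun S hS φ => by
    simp only [SWord.eval_mul]
    exact congrArg _ (Concept.identities_iff.1 h S hS φ)
  mul_right c _ _ h := Concept.identities_iff.2 fun S hS φ => by
    simp only [SWord.eval_mul]
    exact congrArg (· * _) (Concept.identities_iff.1 h S hS φ)

/-- The identity `w ≈ 0` says that all values of `w` are zero elements. -/
theorem holdsZero_iff {w : SWord} :
    V.HoldsZero w ↔ ∀ S ∈ V.extent, ∀ φ : ℕ → S.carrier, IsZeroElement (SWord.eval φ w) := by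
  constructor
  · intro h S hS φ a
    obtain ⟨x, hx⟩ := Infinite.exists_notMem_finset w.content
    have hw : SWord.eval (Function.update φ x a) w = SWord.eval φ w :=
      SWord.eval_congr fun i hi => Function.update_of_ne (by rintro rfl; exact hx hi) _ _
    have h1 := (h x hx).1 S hS (Function.update φ x a)
    have h2 := (h x hx).2 S hS (Function.update φ x a)
    simp only [SWord.eval_mul, SWord.eval_of, hw, Function.update_self] at h1 h2
    exact ⟨h1, h2⟩
  · intro h x _
    refine ⟨fun S hS φ => ?_, fun S hS φ => ?_⟩
    · simp only [SWord.eval_mul]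
      exact (h S hS φ _).1
    · simp only [SWord.eval_mul]
      exact (h S hS φ _).2

/-- A nil-variety satisfies some identity `w ≈ 0`: any word that represents the zero of its free
algebra will do. -/
theorem exists_holdsZero (hN : N.IsNil) : ∃ w, N.HoldsZero w := by
  obtain ⟨S, π, hπ, hmul, hiff, hS⟩ := (isCongruence_identities N).exists_model
  have hSN : S ∈ N.extent := Concept.mem_extent_iff.2 fun p q h => (hS p q).2 h
  obtain ⟨z, hz, -⟩ := hN S hSN
  obtain ⟨w, rfl⟩ := hπ z
  refine ⟨w, fun x _ => ⟨?_, ?_⟩⟩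
  · refine Concept.identities_iff.1 ((hiff _ _).1 ?_)
    rw [hmul]
    exact (hz _).1
  · refine Concept.identities_iff.1 ((hiff _ _).1 ?_)
    rw [hmul]
    exact (hz _).2

theorem isZeroElement_eval {S : Type v} [Semigroup S] {φ : ℕ → S} {w : SWord} {i : ℕ}
    (hi : i ∈ w.content) (h : IsZeroElement (φ i)) : IsZeroElement (SWord.eval φ w) := by
  induction w using SWord.induction with
  | of j =>
    rw [SWord.content_of, Finset.mem_singleton] at hi
    exact hi ▸ h
  | of_mul j w ih =>
    rw [SWord.content_mul, SWord.content_of, Finset.mem_union, Finset.mem_singleton] at hi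
    rw [SWord.eval_mul]
    rcases hi with rfl | hi
    · exact h.mul_right _
    · exact (ih hi).mul_left _

theorem isZeroIdeal (hN : N.IsNil) (hA : N.ConditionA) :
    WordAlgebra.IsZeroIdeal N.identities {w | N.HoldsZero w} where
  nonempty := exists_holdsZero hN
  subst f w hw := holdsZero_iff.2 fun S hS φ => by
    change IsZeroElement (SWord.eval φ (SWord.eval f w))
    rw [SWord.eval_eval]
    exact holdsZero_iff.1 hw S hS _
  subst_mem {f w i} hi hw := holdsZero_iff.2 fun S hS φ => by
    change IsZeroElement (SWord.eval φ (SWord.eval f w))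
    rw [SWord.eval_eval]
    exact isZeroElement_eval hi (holdsZero_iff.1 hw S hS φ)
  rel hp hq := Concept.identities_iff.2 fun S hS φ =>
    (holdsZero_iff.1 hp S hS φ).eq (holdsZero_iff.1 hq S hS φ)
  exists_content_union {p q} hp hq := ⟨p * q, holdsZero_iff.2 fun S hS φ => by
    rw [SWord.eval_mul]
    exact (holdsZero_iff.1 hp S hS φ).mul_right _, SWord.content_mul p q⟩
  substitutive {p q} h hp := by
    by_contra hcon
    refine hp (hA p q (Concept.identities_iff.1 h) fun hs => hcon ⟨hs.1, ?_⟩).1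
    obtain ⟨σ, hσ⟩ := hs.2
    exact ⟨σ, hσ.trans (SWord.permute_eq_rename σ p).symm⟩

theorem stab_eq (u : SWord) :
    (isCongruence_identities N).isFullyInvariant.stab u.content u = N.stab u := by
  ext σ
  change N.identities u (WordAlgebra.permute _ u) ↔ N.Holds u _
  rw [SWord.permute_eq_rename]
  exact Concept.identities_iff

theorem exists_perm_of_isForbiddenPair (hC : N.ConditionC') {p q : SWord}
    (hc : p.content = q.content)
    (h : IsForbiddenPair ((isCongruence_identities N).isFullyInvariant.stab p.content p)
      ((isCongruence_identities N).isFullyInvariant.stab p.content q)) :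
    ∃ τ, q = WordAlgebra.permute τ p := by
  have h' : IsForbiddenPair (N.stab p) (N.stab q) := by
    rw [← stab_eq, ← stab_eq]
    have : ∀ X, p.content = X →
        IsForbiddenPair ((isCongruence_identities N).isFullyInvariant.stab p.content p)
        ((isCongruence_identities N).isFullyInvariant.stab X q) := by
      rintro _ rfl
      exact h
    exact this _ hc
  have heq : p.Equivalent q := by
    by_contra hne
    exact hC ⟨p, q, hne, hc, h'⟩
  obtain ⟨τ, hτ⟩ := heq.exists_perm hc
  exact ⟨τ, hτ.trans (SWord.permute_eq_rename τ p).symm⟩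

theorem identities_trivialVariety (p q : SWord) : trivialVariety.{u}.identities p q := by
  refine Concept.identities_iff.2 fun S hS φ => ?_
  have h : ∀ a b : S.carrier, a = b := fun a b =>
    hS (Set.mem_singleton _) fun i => if i = 0 then a else b
  exact h _ _

theorem identities_semilattices (p q : SWord) :
    semilattices.{u}.identities p q ↔ p.content = q.content := by
  constructor
  · intro h
    let B : SemigroupModel.{u} :=
      @SemigroupModel.mk (ULift.{u} Bool)
        { mul := fun a b => ⟨a.down && b.down⟩
          mul_assoc := fun a b c => congrArg ULift.up (Bool.and_assoc _ _ _) } ⟨⟨true⟩⟩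
    have hmul : ∀ a b : B.carrier, ULift.down (a * b) = (ULift.down a && ULift.down b) :=
      fun _ _ => rfl
    have hB : B ∈ semilattices.{u}.extent := by
      rintro _ (rfl | rfl) φ
      · exact congrArg ULift.up (Bool.and_self _)
      · exact congrArg ULift.up (Bool.and_comm _ _)
    have heval : ∀ (φ : ℕ → B.carrier) w,
        ULift.down (SWord.eval φ w) = true ↔ ∀ i ∈ w.content, ULift.down (φ i) = true := by
      intro φ w
      induction w using SWord.induction with
      | of i => simp [SWord.eval_of, SWord.content_of]
      | of_mul i w ih =>
        simp [SWord.eval_mul, SWord.content_mul, SWord.content_of, hmul, ih, SWord.eval_of]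
    -- The assignment that is false exactly at `i` detects whether `i` occurs in a word.
    have key : ∀ i, i ∉ p.content ↔ i ∉ q.content := by
      intro i
      let φ : ℕ → B.carrier := fun j => ULift.up (decide (j ≠ i))
      have hφ : ∀ w : SWord, i ∉ w.content ↔ ULift.down (SWord.eval φ w) = true := by
        intro w
        rw [heval]
        constructor
        · intro h j hj
          exact decide_eq_true (by rintro rfl; exact h hj)
        · intro h hi
          exact absurd rfl (of_decide_eq_true (h i hi))
      rw [hφ, hφ, Concept.identities_iff.1 h B hB φ]
    ext i
    exact not_iff_not.1 (key i)
  · intro h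
    refine Concept.identities_iff.2 fun S hS φ => ?_
    have hidem : ∀ a : S.carrier, a * a = a := fun a => hS (Or.inl rfl) fun _ => a
    have hcomm : ∀ a b : S.carrier, a * b = b * a := fun a b => by
      have := hS (Or.inr rfl) fun i => if i = 0 then a else b
      exact this
    -- In a semilattice, values of words are absorbed according to the letters that occur.
    have habs : ∀ w : SWord, ∀ i ∈ w.content, φ i * SWord.eval φ w = SWord.eval φ w := by
      intro w
      induction w using SWord.induction with
      | of j =>
        intro i hi
        rw [SWord.content_of, Finset.mem_singleton] at hi
        subst hi
        exact hidem _
      | of_mul j w ih =>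
        intro i hi
        rw [SWord.content_mul, SWord.content_of, Finset.mem_union, Finset.mem_singleton] at hi
        rw [SWord.eval_mul, SWord.eval_of]
        rcases hi with rfl | hi
        · rw [← mul_assoc, hidem]
        · rw [← mul_assoc, hcomm (φ i), mul_assoc, ih i hi]
    have habs' : ∀ w w' : SWord, w'.content ⊆ w.content →
        SWord.eval φ w' * SWord.eval φ w = SWord.eval φ w := by
      intro w w'
      induction w' using SWord.induction with
      | of j => exact fun h => habs w j (h (by simp [SWord.content_of]))
      | of_mul j w' ih =>
        intro h
        rw [SWord.content_mul, SWord.content_of, Finset.union_subset_iff,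
          Finset.singleton_subset_iff] at h
        rw [SWord.eval_mul, mul_assoc, ih h.2, SWord.eval_of, habs w j h.1]
    have h1 := habs' p q h.ge
    have h2 := habs' q p h.le
    rw [← h1, hcomm]
    exact h2

theorem isModularElement_sup {M N : SemigroupVariety.{u}}
    (hM : M = trivialVariety ∨ M = semilattices) (hN : N.IsNil) (hA : N.ConditionA)
    (hB : N.ConditionB) (hC : N.ConditionC') : IsModularElement (M ⊔ N) := by
  rw [sup_comm]
  intro y z hyz
  have hI := isZeroIdeal hN hA
  have hsup : (N ⊔ M).identities = fun p q => N.identities p q ∧ M.identities p q := by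
    ext p q
    exact Concept.identities_sup
  have hmod : ∀ p, ¬ N.HoldsZero p → ∀ X, p.content = X →
      IsModularElement ((isCongruence_identities N).isFullyInvariant.stab X p) := by
    rintro p hp _ rfl
    rw [stab_eq]
    exact hB p hp
  refine Concept.sup_inf_eq_of_join hyz (isCongruence_identities _).equivalence ?_ ?_
  · obtain ⟨S, -, -, -, -, hS⟩ :=
      ((isCongruence_identities (N ⊔ M)).join (isCongruence_identities z)).exists_model
    exact ⟨S, hS⟩
  · rw [hsup]
    intro p q hpq hy
    refine WordAlgebra.join_inf_of_join (isCongruence_identities N).isFullyInvariant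
      (isCongruence_identities M).isFullyInvariant (isCongruence_identities y).isFullyInvariant
      (isCongruence_identities z).isFullyInvariant hI ?_
      (fun _ _ => Concept.identities_of_le hyz) ?_ ?_ hpq hy
    · rcases hM with rfl | rfl
      · exact Or.inl identities_trivialVariety
      · exact Or.inr identities_semilattices
    · exact fun p hp => hmod p hp _ rfl
    · intro p hp q hq hpq
      rcases (hmod p hp _ rfl).le_or_le_or_isForbiddenPair (hmod q hq _ hpq.symm) with
        h | h | h | h
      · exact Or.inl h
      · exact Or.inr (Or.inl h)
      · exact Or.inr (Or.inr (exists_perm_of_isForbiddenPair hC hpq h))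
      · have h' : IsForbiddenPair
            ((isCongruence_identities N).isFullyInvariant.stab q.content q)
            ((isCongruence_identities N).isFullyInvariant.stab q.content p) := by
          have : ∀ X, p.content = X → IsForbiddenPair
              ((isCongruence_identities N).isFullyInvariant.stab X q)
              ((isCongruence_identities N).isFullyInvariant.stab X p) := by
            rintro _ rfl
            exact h
          exact this _ hpq
        obtain ⟨τ, hτ⟩ := exists_perm_of_isForbiddenPair hC hpq.symm h'
        exact Or.inr (Or.inr ⟨τ⁻¹, by rw [hτ, WordAlgebra.permute_inv_permute]⟩)

end SemigroupVariety

/-! ### Unary words and epigroup varieties -/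

theorem posPow_eq_self {S : Type v} [Semigroup S] {e : S} (he : e * e = e) (n : ℕ) :
    posPow e n = e := by
  induction n with
  | zero => rfl
  | succ n ih => rw [posPow, ih, he]

/-- In a nilsemigroup, pseudoinverses are zero elements: zero is the only idempotent. -/
theorem IsPseudoinverse.isZeroElement {S : Type v} [Semigroup S] (hS : IsNilsemigroup S) {x y : S}
    (h : IsPseudoinverse x y) : IsZeroElement y := by
  obtain ⟨e, he, -, hy, -⟩ := h
  obtain ⟨z, hz, hnil⟩ := hS
  obtain ⟨n, hn⟩ := hnil e
  rw [posPow_eq_self he] at hn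
  subst hn
  have : y = e := hy.1.1.symm.trans (hz y).1
  exact this ▸ hz

namespace UWord

theorem content_mul (a b : UWord) : content (a * b) = content a ∪ content b := by
  change content (mul a b) = _
  induction a with
  | letter i => rfl
  | bar v => rfl
  | letterMul i v ih => simp only [mul, content, ih, Finset.insert_union]
  | barMul v v' _ ih => simp only [mul, content, ih, Finset.union_assoc]

theorem content_nonempty (w : UWord) : w.content.Nonempty := by
  induction w with
  | letter i => exact Finset.singleton_nonempty i
  | bar v ih => exact ih
  | letterMul i v ih => exact Finset.insert_nonempty _ _
  | barMul v v' ih _ => exact ih.mono Finset.subset_union_left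

theorem content_eval (f : ℕ → UWord) (w : UWord) (x : ℕ) :
    x ∈ content (eval f w) ↔ ∃ i ∈ content w, x ∈ content (f i) := by
  have hbar : ∀ w, content (UnarySemigroup.bar w) = content w := fun _ => rfl
  induction w with
  | letter i => simp [eval, content]
  | bar v ih => simp only [eval, hbar, ih, content]
  | letterMul i v ih => simp [eval, content_mul, content, ih]
  | barMul v v' ih ih' =>
    simp only [eval, content_mul, hbar, content, Finset.mem_union, ih, ih', or_and_right,
      exists_or]

theorem eval_eval {S : Type v} [UnarySemigroup S] (φ : ℕ → S) (f : ℕ → UWord) (w : UWord) :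
    eval φ (eval f w) = eval (fun i => eval φ (f i)) w := by
  have hbar : ∀ w, eval φ (UnarySemigroup.bar w) = UnarySemigroup.bar (eval φ w) := fun _ => rfl
  induction w with
  | letter i => rfl
  | bar v ih => simp only [eval, hbar, ih]
  | letterMul i v ih => simp only [eval, eval_mul, ih]
  | barMul v v' ih ih' => simp only [eval, eval_mul, hbar, ih, ih']

theorem eval_congr {S : Type v} [UnarySemigroup S] {φ ψ : ℕ → S} {w : UWord}
    (h : ∀ i ∈ content w, φ i = ψ i) : eval φ w = eval ψ w := by
  induction w with
  | letter i => exact h i (by simp [content])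
  | bar v ih => rw [eval, eval, ih h]
  | letterMul i v ih =>
    rw [eval, eval, h i (Finset.mem_insert_self _ _),
      ih fun j hj => h j (Finset.mem_insert_of_mem hj)]
  | barMul v v' ih ih' =>
    rw [eval, eval, ih fun j hj => h j (Finset.mem_union_left _ hj),
      ih' fun j hj => h j (Finset.mem_union_right _ hj)]

theorem eval_letter (w : UWord) : eval letter w = w := by
  induction w with
  | letter i => rfl
  | bar v ih => rw [eval, ih]; rfl
  | letterMul i v ih => rw [eval, ih]; rfl
  | barMul v v' ih ih' => rw [eval, ih, ih']; rfl

theorem rename_eq_eval (f : ℕ → ℕ) (w : UWord) :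
    rename f w = eval (fun i => letter (f i)) w := by
  rw [← eval_letter (rename f w), eval_rename]
  rfl

instance : WordAlgebra UWord where
  letter := letter
  subst f w := eval f w
  content := content
  content_nonempty := content_nonempty
  subst_letter _ _ := rfl
  subst_letter_self := eval_letter
  subst_subst f g w := eval_eval g f w
  subst_congr _ _ _ := eval_congr
  mem_content_subst := content_eval
  mem_content_letter i x := by simp [content]

theorem permute_eq_rename (σ : Equiv.Perm ℕ) (w : UWord) :
    WordAlgebra.permute σ w = w.rename σ := (rename_eq_eval σ w).symm

theorem ofSWord_mul (a b : SWord) : ofSWord (a * b) = ofSWord a * ofSWord b :=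
  SWord.eval_mul _ a b

theorem content_ofSWord (w : SWord) : (ofSWord w).content = w.content := by
  induction w using SWord.induction with
  | of i => rfl
  | of_mul i w ih =>
    rw [ofSWord_mul, content_mul, ih, SWord.content_mul]
    rfl

theorem ofSWord_rename (f : ℕ → ℕ) (w : SWord) :
    ofSWord (w.rename f) = (ofSWord w).rename f := by
  rw [SWord.rename_eq_eval, rename_eq_eval]
  induction w using SWord.induction with
  | of i => rfl
  | of_mul i w ih =>
    rw [SWord.eval_mul, ofSWord_mul, ih, ofSWord_mul, eval_mul]
    rfl

/-- A fully invariant congruence of the free unary semigroup. -/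
structure IsCongruence (R : UWord → UWord → Prop) : Prop where
  equivalence : Equivalence R
  subst : ∀ f {a b}, R a b → R (eval f a) (eval f b)
  mul_left : ∀ c {a b}, R a b → R (c * a) (c * b)
  mul_right : ∀ c {a b}, R a b → R (a * c) (b * c)
  bar : ∀ {a b}, R a b → R (bar a) (bar b)

theorem IsCongruence.mul {R : UWord → UWord → Prop} (hR : IsCongruence R) {a b c d : UWord}
    (h : R a b) (h' : R c d) : R (a * c) (b * d) :=
  hR.equivalence.trans (hR.mul_right c h) (hR.mul_left b h')

theorem IsCongruence.isFullyInvariant {R : UWord → UWord → Prop} (hR : IsCongruence R) :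
    WordAlgebra.IsFullyInvariant R where
  equivalence := hR.equivalence
  subst := hR.subst
  congr {f g} w h := by
    change R (eval f w) (eval g w)
    induction w with
    | letter i => exact h i
    | bar v ih => exact hR.bar ih
    | letterMul i v ih => exact hR.mul (h i) ih
    | barMul v v' ih ih' => exact hR.mul (hR.bar ih) ih'

theorem IsCongruence.join {R T : UWord → UWord → Prop} (hR : IsCongruence R)
    (hT : IsCongruence T) : IsCongruence (WordAlgebra.Join R T) where
  equivalence := WordAlgebra.Join.equivalence hR.equivalence.symm hT.equivalence.symm
  subst f _ _ := WordAlgebra.Join.map (fun _ _ => hR.subst f) fun _ _ => hT.subst f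
  mul_left c _ _ := WordAlgebra.Join.map (R := R) (S := T) (F := (c * ·))
    (fun _ _ => hR.mul_left c) fun _ _ => hT.mul_left c
  mul_right c _ _ := WordAlgebra.Join.map (R := R) (S := T) (F := (· * c))
    (fun _ _ => hR.mul_right c) fun _ _ => hT.mul_right c
  bar := WordAlgebra.Join.map (fun _ _ => hR.bar) fun _ _ => hT.bar

/-- The quotient of the free unary semigroup by a fully invariant congruence satisfies exactly the
identities in the congruence. -/
theorem IsCongruence.exists_model {R : UWord → UWord → Prop} (hR : IsCongruence R) :
    ∃ S : UnaryModel.{u}, ∃ π : UWord → S.carrier, Function.Surjective π ∧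
      (∀ a b, π (a * b) = π a * π b) ∧ (∀ a b, π a = π b ↔ R a b) ∧
      ∀ a b, S.Satisfies (a, b) ↔ R a b := by
  let c : Con UWord := ⟨⟨R, hR.equivalence⟩, hR.mul⟩
  let _ : UnarySemigroup (ULift.{u} c.Quotient) :=
    { toSemigroup := inferInstance
      bar := fun x => ⟨Quotient.map' UWord.bar (fun _ _ h => hR.bar h) x.down⟩ }
  have : Nonempty (ULift.{u} c.Quotient) := ⟨⟨((letter 0 : UWord) : c.Quotient)⟩⟩
  let S : UnaryModel.{u} := ⟨ULift.{u} c.Quotient⟩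
  let π : UWord → S.carrier := fun w => ULift.up (w : c.Quotient)
  have hπ : Function.Surjective π := fun ⟨x⟩ => by
    induction x using Con.induction_on with
    | H w => exact ⟨w, rfl⟩
  have hmul : ∀ a b, π (a * b) = π a * π b := fun _ _ => rfl
  have hbar : ∀ a, π (UWord.bar a) = UnarySemigroup.bar (π a) := fun _ => rfl
  have hiff : ∀ a b, π a = π b ↔ R a b := fun a b => by
    rw [ULift.up_inj]
    exact c.eq
  have heval : ∀ (f : ℕ → UWord) w, eval (fun i => π (f i)) w = π (eval f w) := by
    intro f w
    induction w with
    | letter i => rfl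
    | bar v ih => rw [eval, ih, ← hbar]; rfl
    | letterMul i v ih => rw [eval, ih, ← hmul]; rfl
    | barMul v v' ih ih' => rw [eval, ih, ih', ← hbar, ← hmul]; rfl
  refine ⟨S, π, hπ, hmul, hiff, fun a b => ⟨fun h => ?_, fun h φ => ?_⟩⟩
  · have := h fun i => π (letter i)
    rwa [heval, heval, hiff, eval_letter, eval_letter] at this
  · choose f hf using fun i => hπ (φ i)
    obtain rfl : (fun i => π (f i)) = φ := funext hf
    rw [heval, heval, hiff]
    exact hR.subst f h

end UWord

theorem UnaryVariety.isCongruence_identities (V : UnaryVariety.{u}) :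
    UWord.IsCongruence V.identities where
  equivalence :=
    { refl := fun _ => Concept.identities_iff.2 fun _ _ _ => rfl
      symm := fun h => Concept.identities_iff.2 fun S hS φ =>
        (Concept.identities_iff.1 h S hS φ).symm
      trans := fun h h' => Concept.identities_iff.2 fun S hS φ =>
        (Concept.identities_iff.1 h S hS φ).trans (Concept.identities_iff.1 h' S hS φ) }
  subst f _ _ h := Concept.identities_iff.2 fun S hS φ => by
    simp only [UWord.eval_eval]
    exact Concept.identities_iff.1 h S hS _
  mul_left c _ _ h := Concept.identities_iff.2 fun S hS φ => by
    simp only [UWord.eval_mul]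
    exact congrArg _ (Concept.identities_iff.1 h S hS φ)
  mul_right c _ _ h := Concept.identities_iff.2 fun S hS φ => by
    simp only [UWord.eval_mul]
    exact congrArg (· * _) (Concept.identities_iff.1 h S hS φ)
  bar h := Concept.identities_iff.2 fun S hS φ =>
    congrArg UnarySemigroup.bar (Concept.identities_iff.1 h S hS φ)

namespace EpigroupVariety

open UnaryVariety (isCongruence_identities)

variable {V N : EpigroupVariety.{u}}

/-- The identity `w ≈ 0` says that all values of `w` are zero elements. -/
theorem holdsZero_iff {w : UWord} :
    V.HoldsZero w ↔ ∀ S ∈ V.1.extent, ∀ φ : ℕ → S.carrier, IsZeroElement (UWord.eval φ w) := by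
  constructor
  · intro h S hS φ a
    obtain ⟨x, hx⟩ := Infinite.exists_notMem_finset w.content
    have hw : UWord.eval (Function.update φ x a) w = UWord.eval φ w :=
      UWord.eval_congr fun i hi => Function.update_of_ne (by rintro rfl; exact hx hi) _ _
    have h1 := (h x hx).1 S hS (Function.update φ x a)
    have h2 := (h x hx).2 S hS (Function.update φ x a)
    simp only [UWord.eval_mul, UWord.eval, hw, Function.update_self] at h1 h2
    exact ⟨h1, h2⟩
  · intro h x _
    refine ⟨fun S hS φ => ?_, fun S hS φ => ?_⟩
    · simp only [UWord.eval_mul]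
      exact (h S hS φ _).1
    · simp only [UWord.eval_mul]
      exact (h S hS φ _).2

/-- A nil-variety satisfies some identity `w ≈ 0`: any word that represents the zero of its free
algebra will do. -/
theorem exists_holdsZero (hN : N.IsNil) : ∃ w, N.HoldsZero w := by
  obtain ⟨S, π, hπ, hmul, hiff, hS⟩ := (isCongruence_identities N.1).exists_model
  have hSN : S ∈ N.1.extent := Concept.mem_extent_iff.2 fun p q h => (hS p q).2 h
  obtain ⟨z, hz, -⟩ := hN S hSN
  obtain ⟨w, rfl⟩ := hπ z
  refine ⟨w, fun x _ => ⟨?_, ?_⟩⟩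
  · refine Concept.identities_iff.1 ((hiff _ _).1 ?_)
    rw [hmul]
    exact (hz _).1
  · refine Concept.identities_iff.1 ((hiff _ _).1 ?_)
    rw [hmul]
    exact (hz _).2

theorem isZeroElement_bar (hN : N.IsNil) {S : UnaryModel.{u}} (hS : S ∈ N.1.extent)
    (a : S.carrier) : IsZeroElement (UnarySemigroup.bar a) :=
  (N.2 S hS a).isZeroElement (hN S hS)

theorem isZeroElement_eval (hN : N.IsNil) {S : UnaryModel.{u}} (hS : S ∈ N.1.extent)
    {φ : ℕ → S.carrier} {w : UWord} {i : ℕ} (hi : i ∈ w.content) (h : IsZeroElement (φ i)) :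
    IsZeroElement (UWord.eval φ w) := by
  induction w with
  | letter j =>
    rw [UWord.content, Finset.mem_singleton] at hi
    exact hi ▸ h
  | bar v _ => exact isZeroElement_bar hN hS _
  | letterMul j v ih =>
    rw [UWord.content, Finset.mem_insert] at hi
    rcases hi with rfl | hi
    · exact h.mul_right _
    · exact (ih hi).mul_left _
  | barMul v v' _ _ => exact (isZeroElement_bar hN hS _).mul_right _

theorem isZeroIdeal (hN : N.IsNil) (hA : N.ConditionA) :
    WordAlgebra.IsZeroIdeal N.1.identities {w | N.HoldsZero w} where
  nonempty := exists_holdsZero hN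
  subst f w hw := holdsZero_iff.2 fun S hS φ => by
    change IsZeroElement (UWord.eval φ (UWord.eval f w))
    rw [UWord.eval_eval]
    exact holdsZero_iff.1 hw S hS _
  subst_mem {f w i} hi hw := holdsZero_iff.2 fun S hS φ => by
    change IsZeroElement (UWord.eval φ (UWord.eval f w))
    rw [UWord.eval_eval]
    exact isZeroElement_eval hN hS hi (holdsZero_iff.1 hw S hS φ)
  rel hp hq := Concept.identities_iff.2 fun S hS φ =>
    (holdsZero_iff.1 hp S hS φ).eq (holdsZero_iff.1 hq S hS φ)
  exists_content_union {p q} hp hq := ⟨p * q, holdsZero_iff.2 fun S hS φ => by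
    rw [UWord.eval_mul]
    exact (holdsZero_iff.1 hp S hS φ).mul_right _, UWord.content_mul p q⟩
  substitutive {p q} h hp := by
    by_contra hcon
    refine hp (hA p q (Concept.identities_iff.1 h) fun hs => hcon ⟨hs.1, ?_⟩).1
    obtain ⟨σ, hσ⟩ := hs.2
    exact ⟨σ, hσ.trans (UWord.permute_eq_rename σ p).symm⟩

/-- Words that are not zero in a nil-variety of epigroups do not involve the unary operation. -/
theorem exists_eq_ofSWord (hN : N.IsNil) {w : UWord} (hw : ¬ N.HoldsZero w) :
    ∃ s : SWord, w = UWord.ofSWord s := by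
  induction w with
  | letter i => exact ⟨FreeSemigroup.of i, rfl⟩
  | bar v _ => exact absurd (holdsZero_iff.2 fun S hS φ => isZeroElement_bar hN hS _) hw
  | letterMul i v ih =>
    obtain ⟨s, rfl⟩ := ih fun h => hw <| holdsZero_iff.2 fun S hS φ =>
      (holdsZero_iff.1 h S hS φ).mul_left _
    exact ⟨_, (UWord.ofSWord_mul (FreeSemigroup.of i) s).symm⟩
  | barMul v v' _ _ =>
    exact absurd (holdsZero_iff.2 fun S hS φ => (isZeroElement_bar hN hS _).mul_right _) hw

theorem stab_eq (u : UWord) :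
    (isCongruence_identities N.1).isFullyInvariant.stab u.content u = N.stab u := by
  ext σ
  change N.1.identities u (WordAlgebra.permute _ u) ↔ N.Holds u _
  rw [UWord.permute_eq_rename]
  exact Concept.identities_iff

theorem exists_perm_of_isForbiddenPair (hN : N.IsNil) (hC : N.ConditionC') {p q : UWord}
    (hp : ¬ N.HoldsZero p) (hq : ¬ N.HoldsZero q) (hc : p.content = q.content)
    (h : IsForbiddenPair ((isCongruence_identities N.1).isFullyInvariant.stab p.content p)
      ((isCongruence_identities N.1).isFullyInvariant.stab p.content q)) :
    ∃ τ, q = WordAlgebra.permute τ p := by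
  obtain ⟨s, rfl⟩ := exists_eq_ofSWord hN hp
  obtain ⟨t, rfl⟩ := exists_eq_ofSWord hN hq
  have h' : IsForbiddenPair (N.stab (UWord.ofSWord s)) (N.stab (UWord.ofSWord t)) := by
    rw [← stab_eq, ← stab_eq]
    have : ∀ X, (UWord.ofSWord s).content = X → IsForbiddenPair
        ((isCongruence_identities N.1).isFullyInvariant.stab (UWord.ofSWord s).content
          (UWord.ofSWord s))
        ((isCongruence_identities N.1).isFullyInvariant.stab X (UWord.ofSWord t)) := by
      rintro _ rfl
      exact h
    exact this _ hc
  rw [UWord.content_ofSWord, UWord.content_ofSWord] at hc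
  have heq : s.Equivalent t := by
    by_contra hne
    exact hC ⟨s, t, hne, hc, h'⟩
  obtain ⟨τ, rfl⟩ := heq.exists_perm hc
  exact ⟨τ, (UWord.ofSWord_rename τ s).trans (UWord.permute_eq_rename τ _).symm⟩

theorem identities_trivialVariety (p q : UWord) : trivialVariety.{u}.1.identities p q := by
  refine Concept.identities_iff.2 fun S hS φ => ?_
  have h : ∀ a b : S.carrier, a = b := fun a b =>
    hS (Set.mem_singleton _) fun i => if i = 0 then a else b
  exact h _ _

theorem identities_semilattices (p q : UWord) :
    semilattices.{u}.1.identities p q ↔ p.content = q.content := by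
  constructor
  · intro h
    let _ : UnarySemigroup (ULift.{u} Bool) :=
      { mul := fun a b => ⟨a.down && b.down⟩
        mul_assoc := fun a b c => congrArg ULift.up (Bool.and_assoc _ _ _)
        bar := fun a => a }
    let B : UnaryModel.{u} := ⟨ULift.{u} Bool⟩
    have hmul : ∀ a b : B.carrier, ULift.down (a * b) = (ULift.down a && ULift.down b) :=
      fun _ _ => rfl
    have hbar : ∀ a : B.carrier, UnarySemigroup.bar a = a := fun _ => rfl
    have hB : B ∈ semilattices.{u}.1.extent := by
      rintro _ (rfl | rfl | rfl) φ
      · exact congrArg ULift.up (Bool.and_self _)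
      · exact congrArg ULift.up (Bool.and_comm _ _)
      · rfl
    have heval : ∀ (φ : ℕ → B.carrier) w,
        ULift.down (UWord.eval φ w) = true ↔ ∀ i ∈ w.content, ULift.down (φ i) = true := by
      intro φ w
      induction w with
      | letter i => simp [UWord.eval, UWord.content]
      | bar v ih => rw [UWord.eval, hbar, ih, UWord.content]
      | letterMul i v ih => simp [UWord.eval, UWord.content, hmul, ih]
      | barMul v v' ih ih' =>
        simp [UWord.eval, UWord.content, hmul, hbar, ih, ih', or_imp, forall_and]
    -- The assignment that is false exactly at `i` detects whether `i` occurs in a word.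
    have key : ∀ i, i ∉ p.content ↔ i ∉ q.content := by
      intro i
      let φ : ℕ → B.carrier := fun j => ULift.up (decide (j ≠ i))
      have hφ : ∀ w : UWord, i ∉ w.content ↔ ULift.down (UWord.eval φ w) = true := by
        intro w
        rw [heval]
        constructor
        · intro h j hj
          exact decide_eq_true (by rintro rfl; exact h hj)
        · intro h hi
          exact absurd rfl (of_decide_eq_true (h i hi))
      rw [hφ, hφ, Concept.identities_iff.1 h B hB φ]
    ext i
    exact not_iff_not.1 (key i)
  · intro h
    refine Concept.identities_iff.2 fun S hS φ => ?_
    have hidem : ∀ a : S.carrier, a * a = a := fun a => hS (Or.inl rfl) fun _ => a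
    have hcomm : ∀ a b : S.carrier, a * b = b * a := fun a b =>
      hS (Or.inr (Or.inl rfl)) fun i => if i = 0 then a else b
    have hbar : ∀ a : S.carrier, UnarySemigroup.bar a = a := fun a =>
      hS (Or.inr (Or.inr rfl)) fun _ => a
    -- In a semilattice, values of words are absorbed according to the letters that occur.
    have habs : ∀ w : UWord, ∀ i ∈ w.content, φ i * UWord.eval φ w = UWord.eval φ w := by
      intro w
      induction w with
      | letter j =>
        intro i hi
        rw [UWord.content, Finset.mem_singleton] at hi
        subst hi
        exact hidem _
      | bar v ih => rwa [UWord.eval, hbar]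
      | letterMul j v ih =>
        intro i hi
        rw [UWord.content, Finset.mem_insert] at hi
        rw [UWord.eval]
        rcases hi with rfl | hi
        · rw [← mul_assoc, hidem]
        · rw [← mul_assoc, hcomm (φ i), mul_assoc, ih i hi]
      | barMul v v' ih ih' =>
        intro i hi
        rw [UWord.content, Finset.mem_union] at hi
        rw [UWord.eval, hbar]
        rcases hi with hi | hi
        · rw [← mul_assoc, ih i hi]
        · rw [← mul_assoc, hcomm (φ i), mul_assoc, ih' i hi]
    have habs' : ∀ w w' : UWord, w'.content ⊆ w.content →
        UWord.eval φ w' * UWord.eval φ w = UWord.eval φ w := by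
      intro w w'
      induction w' with
      | letter j => exact fun h => habs w j (h (by simp [UWord.content]))
      | bar v ih => rwa [UWord.eval, hbar]
      | letterMul j v ih =>
        intro h
        rw [UWord.content, Finset.insert_subset_iff] at h
        rw [UWord.eval, mul_assoc, ih h.2, habs w j h.1]
      | barMul v v' ih ih' =>
        intro h
        rw [UWord.content, Finset.union_subset_iff] at h
        rw [UWord.eval, hbar, mul_assoc, ih' h.2, ih h.1]
    have h1 := habs' p q h.ge
    have h2 := habs' q p h.le
    rw [← h1, hcomm]
    exact h2

theorem isModularElement_sup {M N : EpigroupVariety.{u}}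
    (hM : M = trivialVariety ∨ M = semilattices) (hN : N.IsNil) (hA : N.ConditionA)
    (hB : N.ConditionB) (hC : N.ConditionC') : IsModularElement (M ⊔ N) := by
  rw [sup_comm]
  intro y z hyz
  have hI := isZeroIdeal hN hA
  have hsup : (N.1 ⊔ M.1).identities = fun p q => N.1.identities p q ∧ M.1.identities p q := by
    ext p q
    exact Concept.identities_sup
  have hmod : ∀ p, ¬ N.HoldsZero p → ∀ X, p.content = X →
      IsModularElement ((isCongruence_identities N.1).isFullyInvariant.stab X p) := by
    rintro p hp _ rfl
    rw [stab_eq]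
    exact hB p hp
  refine Subtype.ext (Concept.sup_inf_eq_of_join (x := N.1 ⊔ M.1) (y := y.1) (z := z.1) hyz
    (isCongruence_identities _).equivalence ?_ ?_)
  · obtain ⟨S, -, -, -, -, hS⟩ :=
      ((isCongruence_identities (N.1 ⊔ M.1)).join (isCongruence_identities z.1)).exists_model
    exact ⟨S, hS⟩
  · rw [hsup]
    intro p q hpq hy
    refine WordAlgebra.join_inf_of_join (isCongruence_identities N.1).isFullyInvariant
      (isCongruence_identities M.1).isFullyInvariant
      (isCongruence_identities y.1).isFullyInvariant
      (isCongruence_identities z.1).isFullyInvariant hI ?_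
      (fun _ _ => Concept.identities_of_le hyz) ?_ ?_ hpq hy
    · rcases hM with rfl | rfl
      · exact Or.inl identities_trivialVariety
      · exact Or.inr identities_semilattices
    · exact fun p hp => hmod p hp _ rfl
    · intro p hp q hq hpq
      rcases (hmod p hp _ rfl).le_or_le_or_isForbiddenPair (hmod q hq _ hpq.symm) with
        h | h | h | h
      · exact Or.inl h
      · exact Or.inr (Or.inl h)
      · exact Or.inr (Or.inr (exists_perm_of_isForbiddenPair hN hC hp hq hpq h))
      · have h' : IsForbiddenPair
            ((isCongruence_identities N.1).isFullyInvariant.stab q.content q)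
            ((isCongruence_identities N.1).isFullyInvariant.stab q.content p) := by
          have : ∀ X, p.content = X → IsForbiddenPair
              ((isCongruence_identities N.1).isFullyInvariant.stab X q)
              ((isCongruence_identities N.1).isFullyInvariant.stab X p) := by
            rintro _ rfl
            exact h
          exact this _ hpq
        obtain ⟨τ, hτ⟩ := exists_perm_of_isForbiddenPair hN hC hq hp hpq.symm h'
        exact Or.inr (Or.inr ⟨τ⁻¹, by rw [hτ, WordAlgebra.permute_inv_permute]⟩)

end EpigroupVariety

theorem theorem1p2 :
    (∀ M N : SemigroupVariety.{u},
      (M = SemigroupVariety.trivialVariety ∨ M = SemigroupVariety.semilattices) →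
      N.IsNil → N.ConditionA → N.ConditionB → N.ConditionC' →
      IsModularElement (M ⊔ N)) ∧
    (∀ M N : EpigroupVariety.{u},
      (M = EpigroupVariety.trivialVariety ∨ M = EpigroupVariety.semilattices) →
      N.IsNil → N.ConditionA → N.ConditionB → N.ConditionC' →
      IsModularElement (M ⊔ N)) :=
  ⟨fun _ _ hM hN hA hB hC => SemigroupVariety.isModularElement_sup hM hN hA hB hC,
    fun _ _ hM hN hA hB hC => EpigroupVariety.isModularElement_sup hM hN hA hB hC⟩
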